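/- **Setup.** Let $\tilde B$ be an $(n+m)\times n$ integer matrix with skew-symmetric principal part, let $\mathcal F=\mathbb C(x_1,\dots,x_{n+m})$, and consider all seeds obtained by iterated mutation at the mutable indices $1,\dots,n$ from the seed $((x_1,\dots,x_{n+m}),\tilde B)$. Here the mutation at $k$ replaces $z_k$ by $z_k^{-1}\bigl(\prod_{b_{ik}>0}z_i^{b_{ik}}+\prod_{b_{ik}<0}z_i^{-b_{ik}}\bigr)$ and applies matrix mutation to $\tilde B$. - The cluster algebra $A\subset\mathcal F$ is generated over $\mathbb C[x_{n+1}^{\pm1},\dots,x_{n+m}^{\pm1}]$ by the cluster variables $z_1,\dots,z_n$ of all seeds. The upper cluster algebra is $U=\bigcap_{(\mathbf z,\tilde B')}\mathbb C[z_1^{\pm1},\dots,z_{n+m}^{\pm1}]$, the intersection running over all seeds. Let $\mathcal A=\operatorname{Spec}A$ and $\mathcal U=\operatorname{Spec}U$; a point means a $\mathbb C$-point. Every seed $t$ gives a cluster torus $T(t)=\operatorname{Spec}\mathbb C[z_1^{\pm1},\dots,z_{n+m}^{\pm1}]$ in $\mathcal A$ and in $\mathcal U$. - $\operatorname{Aut}(A)$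 is the group of $\mathbb C$-algebra automorphisms of $A$ that multiply each cluster variable and each frozen variable $x_{n+1},\dots,x_{n+m}$ by a nonzero scalar. These automorphisms extend uniquely to $\mathcal F$, and the extensions preserve $U$, so $\operatorname{Aut}(A)$ acts on $\mathcal A$ and on $\mathcal U$. - For $\mathcal X\in\{\mathcal A,\mathcal U\}$, the deep locus is $\mathcal D(\mathcal X)=\mathcal X\setminus\bigcup_tT(t)$, and the stabilizer locus $\mathcal S(\mathcal X)$ is the set of points with nontrivial stabilizer in $\operatorname{Aut}(A)$. A mysterious point is an element of $\mathcal D(\mathcal X)\setminus\mathcal S(\mathcal X)$, and $A$ (respectively $U$) has no mysterious points if $\mathcal S(\mathcal X)=\mathcal D(\mathcal X)$ for $\mathcal X=\mathcal A$ (respectively $\mathcal X=\mathcal U$). Let $$B=\begin{pmatrix}0&-2&2\\2&0&-2\\-2&2&0\end{pmatrix},\qquad \tilde B_{\mathrm{prin}}=\begin{pmatrix}B\\ I_3\end{pmatrix}.$$ **Proposition.** 1. The Markov cluster algebra with principal coefficients $A_{\mathrm{prin}}=A(\tilde B_{\mathrm{prin}})$ has no mysterious points. 2. Its upper cluster algebra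 $U_{\mathrm{prin}}=U(\tilde B_{\mathrm{prin}})$ has mysterious points: there is a point of $\mathcal D(\mathcal U_{\mathrm{prin}})$ whose stabilizer in $\operatorname{Aut}(A_{\mathrm{prin}})$ is trivial. 3. For the coefficient-free Markov matrix $B$ (with $n=3$, $m=0$), the cluster algebra $A(B)$ and the upper cluster algebra $U(B)$ both have no mysterious points. -/

import Mathlib

namespace ClusterAlg

/-- The ambient field `ℱ = ℂ(x₁, …, xₙ₊ₘ)`; `Sum.inl` indexes the `n` mutable directions and
`Sum.inr` the `m` frozen ones. -/
abbrev RatFun (n m : ℕ) : Type := FractionRing (MvPolynomial (Fin n ⊕ Fin m) ℂ)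

/-- A labelled seed: an extended cluster together with an extended exchange matrix. The theory is
applied to seeds obtained by iterated mutation from the seed formed by the coordinate functions of
`ℱ` and a matrix with skew-symmetric principal part; all of these have an extended cluster that
freely generates `ℱ` and a matrix with skew-symmetric principal part. -/
@[ext]
structure Seed (n m : ℕ) where
  /-- the extended cluster -/
  var : Fin n ⊕ Fin m → RatFun n m
  /-- the extended exchange matrix -/
  mat : Matrix (Fin n ⊕ Fin m) (Fin n) ℤ

/-- Mutation of an extended exchange matrix in the mutable direction `k`. -/
def mutateMatrix {n m : ℕ} (B : Matrix (Fin n ⊕ Fin m) (Fin n) ℤ) (k : Fin n) :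
    Matrix (Fin n ⊕ Fin m) (Fin n) ℤ :=
  fun i j =>
    if i = Sum.inl k ∨ j = k then -B i j
    else B i j + max (B i k) 0 * max (B (Sum.inl k) j) 0
      - max (-B i k) 0 * max (-B (Sum.inl k) j) 0

/-- Seed mutation in the mutable direction `k`. -/
noncomputable def Seed.mutate {n m : ℕ} (t : Seed n m) (k : Fin n) : Seed n m where
  var := Function.update t.var (Sum.inl k)
    ((t.var (Sum.inl k))⁻¹ *
      (∏ i, t.var i ^ (t.mat i k).toNat + ∏ i, t.var i ^ (-t.mat i k).toNat))
  mat := mutateMatrix t.mat k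

/-- The initial seed: the coordinate functions of `ℱ` with the exchange matrix `B`. -/
noncomputable def initialSeed {n m : ℕ} (B : Matrix (Fin n ⊕ Fin m) (Fin n) ℤ) : Seed n m where
  var := fun i => algebraMap (MvPolynomial (Fin n ⊕ Fin m) ℂ) (RatFun n m) (MvPolynomial.X i)
  mat := B

/-- `IsSeed B t`: the seed `t` is obtained from the initial seed by iterated mutations. -/
inductive IsSeed {n m : ℕ} (B : Matrix (Fin n ⊕ Fin m) (Fin n) ℤ) : Seed n m → Prop
  | initial : IsSeed B (initialSeed B)
  | mutate (t : Seed n m) (k : Fin n) : IsSeed B t → IsSeed B (t.mutate k)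

/-- The mutable cluster variables of all seeds. -/
def clusterVariables {n m : ℕ} (B : Matrix (Fin n ⊕ Fin m) (Fin n) ℤ) : Set (RatFun n m) :=
  {z | ∃ t : Seed n m, IsSeed B t ∧ ∃ i : Fin n, z = t.var (Sum.inl i)}

/-- The frozen variables. -/
def frozenVariables {n m : ℕ} (B : Matrix (Fin n ⊕ Fin m) (Fin n) ℤ) : Set (RatFun n m) :=
  Set.range fun j : Fin m => (initialSeed B).var (Sum.inr j)

/-- The cluster algebra, with inverted frozen variables: the subalgebra of `ℱ` generated by all
cluster variables, the frozen variables and the inverses of the frozen variables. -/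
noncomputable def clusterAlgebra {n m : ℕ} (B : Matrix (Fin n ⊕ Fin m) (Fin n) ℤ) :
    Subalgebra ℂ (RatFun n m) :=
  Algebra.adjoin ℂ (clusterVariables B ∪ frozenVariables B ∪ {z | z⁻¹ ∈ frozenVariables B})

/-- The ring of Laurent polynomials in the extended cluster of the seed `t`. -/
noncomputable def laurentRing {n m : ℕ} (t : Seed n m) : Subalgebra ℂ (RatFun n m) :=
  Algebra.adjoin ℂ (Set.range t.var ∪ Set.range fun i => (t.var i)⁻¹)

/-- The upper cluster algebra: the elements of `ℱ` that are Laurent polynomials in the extended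
cluster of every seed. -/
noncomputable def upperClusterAlgebra {n m : ℕ} (B : Matrix (Fin n ⊕ Fin m) (Fin n) ℤ) :
    Subalgebra ℂ (RatFun n m) :=
  ⨅ (t : Seed n m) (_ : IsSeed B t), laurentRing t

/-- The group of cluster automorphisms: the `ℂ`-algebra automorphisms of the cluster algebra that
rescale each cluster variable and each frozen variable. -/
def clusterAut {n m : ℕ} (B : Matrix (Fin n ⊕ Fin m) (Fin n) ℤ) :
    Subgroup (clusterAlgebra B ≃ₐ[ℂ] clusterAlgebra B) where
  carrier := {φ | ∀ z : clusterAlgebra B,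
    (z : RatFun n m) ∈ clusterVariables B ∪ frozenVariables B →
      ∃ ζ : ℂ, ζ ≠ 0 ∧ φ z = ζ • z}
  one_mem' := fun z _ => ⟨1, one_ne_zero, by simp⟩
  mul_mem' := by
    intro φ ψ hφ hψ z hz
    obtain ⟨a, ha, hφz⟩ := hφ z hz
    obtain ⟨b, hb, hψz⟩ := hψ z hz
    exact ⟨b * a, mul_ne_zero hb ha, by
      rw [AlgEquiv.mul_apply, hψz, map_smul, hφz, smul_smul]⟩
  inv_mem' := by
    intro φ hφ z hz
    obtain ⟨a, ha, hφz⟩ := hφ z hz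
    refine ⟨a⁻¹, inv_ne_zero ha, ?_⟩
    apply φ.injective
    rw [map_smul, hφz, smul_smul, inv_mul_cancel₀ ha, one_smul]
    exact φ.apply_symm_apply z

/-! ### Cluster automorphisms act on the upper cluster algebra -/

theorem IsSeed.var_inr {n m : ℕ} {B : Matrix (Fin n ⊕ Fin m) (Fin n) ℤ} {t : Seed n m}
    (h : IsSeed B t) (j : Fin m) : t.var (Sum.inr j) = (initialSeed B).var (Sum.inr j) := by
  induction h with
  | initial => rfl
  | mutate t k _ ih => simpa [Seed.mutate] using ih

theorem IsSeed.var_mem {n m : ℕ} {B : Matrix (Fin n ⊕ Fin m) (Fin n) ℤ} {t : Seed n m}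
    (h : IsSeed B t) (i : Fin n ⊕ Fin m) :
    t.var i ∈ clusterVariables B ∪ frozenVariables B := by
  rcases i with i | j
  · exact Or.inl ⟨t, h, i, rfl⟩
  · exact Or.inr ⟨j, (h.var_inr j).symm⟩

theorem IsSeed.var_mem_clusterAlgebra {n m : ℕ} {B : Matrix (Fin n ⊕ Fin m) (Fin n) ℤ}
    {t : Seed n m} (h : IsSeed B t) (i : Fin n ⊕ Fin m) : t.var i ∈ clusterAlgebra B :=
  Algebra.subset_adjoin (Or.inl (h.var_mem i))

theorem algebraMap_mem_clusterAlgebra {n m : ℕ} (B : Matrix (Fin n ⊕ Fin m) (Fin n) ℤ)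
    (p : MvPolynomial (Fin n ⊕ Fin m) ℂ) :
    algebraMap (MvPolynomial (Fin n ⊕ Fin m) ℂ) (RatFun n m) p ∈ clusterAlgebra B := by
  induction p using MvPolynomial.induction_on with
  | C a =>
    have h : algebraMap (MvPolynomial (Fin n ⊕ Fin m) ℂ) (RatFun n m) (MvPolynomial.C a)
        = algebraMap ℂ (RatFun n m) a := by
      rw [IsScalarTower.algebraMap_apply ℂ (MvPolynomial (Fin n ⊕ Fin m) ℂ) (RatFun n m)]
      rfl
    rw [h]
    exact Subalgebra.algebraMap_mem _ a
  | add p q hp hq => rw [map_add]; exact add_mem hp hq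
  | mul_X p i hp =>
    rw [map_mul]
    exact mul_mem hp (IsSeed.initial.var_mem_clusterAlgebra i)

/-- `ℱ` is the fraction field of the cluster algebra. -/
instance isFractionRing_clusterAlgebra {n m : ℕ} (B : Matrix (Fin n ⊕ Fin m) (Fin n) ℤ) :
    IsFractionRing (clusterAlgebra B) (RatFun n m) :=
  IsFractionRing.of_field (clusterAlgebra B) (RatFun n m) (fun z => by
    obtain ⟨p, q, -, rfl⟩ := IsFractionRing.div_surjective (MvPolynomial (Fin n ⊕ Fin m) ℂ) z
    exact ⟨⟨_, algebraMap_mem_clusterAlgebra B p⟩, ⟨_, algebraMap_mem_clusterAlgebra B q⟩, rfl⟩)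

/-- The extension of a cluster automorphism to the field `ℱ`. -/
noncomputable def fieldAut {n m : ℕ} (B : Matrix (Fin n ⊕ Fin m) (Fin n) ℤ) :
    clusterAut B →* (RatFun n m ≃ₐ[ℂ] RatFun n m) :=
  (IsFractionRing.fieldEquivOfAlgEquivHom ℂ (RatFun n m)).comp (clusterAut B).subtype

theorem fieldAut_coe {n m : ℕ} {B : Matrix (Fin n ⊕ Fin m) (Fin n) ℤ} (φ : clusterAut B)
    (a : clusterAlgebra B) :
    fieldAut B φ (a : RatFun n m) = ((φ : clusterAlgebra B ≃ₐ[ℂ] clusterAlgebra B) a) :=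
  IsFractionRing.fieldEquivOfAlgEquiv_algebraMap ℂ (RatFun n m) (RatFun n m)
    (φ : clusterAlgebra B ≃ₐ[ℂ] clusterAlgebra B) a

theorem fieldAut_mem_laurentRing {n m : ℕ} {B : Matrix (Fin n ⊕ Fin m) (Fin n) ℤ}
    (φ : clusterAut B) {t : Seed n m} (ht : IsSeed B t) {u : RatFun n m}
    (hu : u ∈ laurentRing t) : fieldAut B φ u ∈ laurentRing t := by
  have hvar : ∀ i, ∃ ζ : ℂ, fieldAut B φ (t.var i) = ζ • t.var i := fun i => by
    obtain ⟨ζ, -, h⟩ := φ.2 ⟨t.var i, ht.var_mem_clusterAlgebra i⟩ (ht.var_mem i)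
    exact ⟨ζ, by rw [fieldAut_coe φ ⟨t.var i, ht.var_mem_clusterAlgebra i⟩, h]; rfl⟩
  suffices h : laurentRing t ≤
      (laurentRing t).comap (AlgEquiv.toAlgHom (fieldAut B φ)) from h hu
  refine Algebra.adjoin_le ?_
  rintro _ (⟨i, rfl⟩ | ⟨i, rfl⟩)
  · obtain ⟨ζ, h⟩ := hvar i
    change fieldAut B φ (t.var i) ∈ laurentRing t
    rw [h, Algebra.smul_def]
    exact mul_mem (Subalgebra.algebraMap_mem _ ζ) (Algebra.subset_adjoin (Or.inl ⟨i, rfl⟩))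
  · obtain ⟨ζ, h⟩ := hvar i
    change fieldAut B φ (t.var i)⁻¹ ∈ laurentRing t
    rw [map_inv₀, h, Algebra.smul_def, mul_inv, ← map_inv₀]
    exact mul_mem (Subalgebra.algebraMap_mem _ ζ⁻¹) (Algebra.subset_adjoin (Or.inr ⟨i, rfl⟩))

theorem fieldAut_mem_upper {n m : ℕ} {B : Matrix (Fin n ⊕ Fin m) (Fin n) ℤ}
    (φ : clusterAut B) {u : RatFun n m} (hu : u ∈ upperClusterAlgebra B) :
    fieldAut B φ u ∈ upperClusterAlgebra B := by
  simp only [upperClusterAlgebra, Algebra.mem_iInf] at hu ⊢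
  exact fun t ht => fieldAut_mem_laurentRing φ ht (hu t ht)

/-- The action of the cluster automorphisms on the upper cluster algebra, by extending a cluster
automorphism to `ℱ` and restricting the extension. -/
noncomputable def upperAction {n m : ℕ} (B : Matrix (Fin n ⊕ Fin m) (Fin n) ℤ) :
    clusterAut B →* (upperClusterAlgebra B ≃ₐ[ℂ] upperClusterAlgebra B) where
  toFun φ := AlgEquiv.ofAlgHom
    (((fieldAut B φ : RatFun n m →ₐ[ℂ] RatFun n m).comp (upperClusterAlgebra B).val).codRestrict
      (upperClusterAlgebra B) fun u => fieldAut_mem_upper φ u.2)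
    (((fieldAut B φ⁻¹ : RatFun n m →ₐ[ℂ] RatFun n m).comp (upperClusterAlgebra B).val).codRestrict
      (upperClusterAlgebra B) fun u => fieldAut_mem_upper φ⁻¹ u.2)
    (by
      ext u
      change fieldAut B φ (fieldAut B φ⁻¹ (u : RatFun n m)) = u
      rw [← AlgEquiv.mul_apply, ← map_mul, mul_inv_cancel, map_one, AlgEquiv.one_apply])
    (by
      ext u
      change fieldAut B φ⁻¹ (fieldAut B φ (u : RatFun n m)) = u
      rw [← AlgEquiv.mul_apply, ← map_mul, inv_mul_cancel, map_one, AlgEquiv.one_apply])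
  map_one' := by
    ext u
    change fieldAut B 1 (u : RatFun n m) = u
    rw [map_one, AlgEquiv.one_apply]
  map_mul' φ ψ := by
    ext u
    change fieldAut B (φ * ψ) (u : RatFun n m) = fieldAut B φ (fieldAut B ψ (u : RatFun n m))
    rw [map_mul, AlgEquiv.mul_apply]

/-! ### Points, cluster tori, deep locus and stabilizer locus -/

/-- The `ℂ`-points of `Spec R`. -/
abbrev Points {n m : ℕ} (R : Subalgebra ℂ (RatFun n m)) : Type := R →ₐ[ℂ] ℂ

/-- The cluster torus of the seed `t` in `Spec R`, for `R` the cluster algebra or the upper cluster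
algebra: the image of the torus `Spec` of the Laurent ring of `t` under restriction along
`R ⊆ laurentRing t`. -/
def clusterTorus {n m : ℕ} (R : Subalgebra ℂ (RatFun n m)) (t : Seed n m) : Set (Points R) :=
  {p | ∃ q : Points (laurentRing t), ∀ (f : RatFun n m) (hR : f ∈ R) (hL : f ∈ laurentRing t),
    p ⟨f, hR⟩ = q ⟨f, hL⟩}

/-- The deep locus of `Spec R`: the complement of the union of all cluster tori. -/
def deepLocus {n m : ℕ} (B : Matrix (Fin n ⊕ Fin m) (Fin n) ℤ) (R : Subalgebra ℂ (RatFun n m)) :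
    Set (Points R) :=
  {p | ∀ t : Seed n m, IsSeed B t → p ∉ clusterTorus R t}

/-- The stabilizer of a point of `Spec R` under a group acting on `R` by algebra automorphisms. -/
def pointStabilizer {G : Type*} [Group G] {n m : ℕ} {R : Subalgebra ℂ (RatFun n m)}
    (ρ : G →* (R ≃ₐ[ℂ] R)) (p : Points R) : Subgroup G where
  carrier := {g | ∀ r : R, p (ρ g r) = p r}
  one_mem' := fun r => by simp
  mul_mem' := by
    intro g h hg hh r
    rw [map_mul, AlgEquiv.mul_apply, hg, hh]
  inv_mem' := by
    intro g hg r
    rw [← hg, ← AlgEquiv.mul_apply, ← map_mul, mul_inv_cancel, map_one, AlgEquiv.one_apply]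

/-- The stabilizer locus: the points with nontrivial stabilizer. -/
def stabilizerLocus {G : Type*} [Group G] {n m : ℕ} {R : Subalgebra ℂ (RatFun n m)}
    (ρ : G →* (R ≃ₐ[ℂ] R)) : Set (Points R) :=
  {p | pointStabilizer ρ p ≠ ⊥}

/-- The action of the cluster automorphisms on the cluster algebra. -/
noncomputable def clusterAction {n m : ℕ} (B : Matrix (Fin n ⊕ Fin m) (Fin n) ℤ) :
    clusterAut B →* (clusterAlgebra B ≃ₐ[ℂ] clusterAlgebra B) :=
  (clusterAut B).subtype

/-- The cluster algebra has no mysterious points. -/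
def ClusterHasNoMysteriousPoints {n m : ℕ} (B : Matrix (Fin n ⊕ Fin m) (Fin n) ℤ) : Prop :=
  stabilizerLocus (clusterAction B) = deepLocus B (clusterAlgebra B)

/-- The upper cluster algebra has no mysterious points. -/
def UpperHasNoMysteriousPoints {n m : ℕ} (B : Matrix (Fin n ⊕ Fin m) (Fin n) ℤ) : Prop :=
  stabilizerLocus (upperAction B) = deepLocus B (upperClusterAlgebra B)

/-- The mysterious points of the upper cluster algebra. -/
def upperMysteriousPoints {n m : ℕ} (B : Matrix (Fin n ⊕ Fin m) (Fin n) ℤ) :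
    Set (Points (upperClusterAlgebra B)) :=
  deepLocus B (upperClusterAlgebra B) \ stabilizerLocus (upperAction B)

/-! ### The Markov exchange matrices -/

/-- The principal part: the exchange matrix of the Markov quiver. -/
def markovPrincipal : Matrix (Fin 3) (Fin 3) ℤ :=
  !![0, -2, 2; 2, 0, -2; -2, 2, 0]

/-- The Markov exchange matrix without frozen rows. -/
def markovMatrix : Matrix (Fin 3 ⊕ Fin 0) (Fin 3) ℤ :=
  Matrix.fromRows markovPrincipal 0

/-- The Markov extended exchange matrix with principal coefficients. -/
def markovPrinMatrix : Matrix (Fin 3 ⊕ Fin 3) (Fin 3) ℤ :=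
  Matrix.fromRows markovPrincipal 1

end ClusterAlg

/-! The exchange matrix of every Markov seed is `±B`, so in any seed each exchange relation has the
shape `zₖ zₖ' = u zᵢ² + v zⱼ²` with units `u`, `v`. At a deep point of the spectrum of the cluster
algebra it follows that the same coordinates vanish in all seeds, and the cluster automorphism
flipping the sign of a vanishing coordinate fixes the point.

Geometrically the cluster variables are the arcs of the once-punctured torus, and the upper cluster
algebra also contains closed loops and notched arcs. With principal coefficients there is a
two-parameter family of points in the initial cluster torus along which the notched arcs are
constantly `1` and which converges to a base point where all arcs vanish. Elements of the upper
cluster algebra are regular at the base point because poles could occur only in codimension two: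
every curve in question lies generically in the torus of the initial seed or of one of its three
neighbours. The limit point is deep, and its nonvanishing notched arcs force a trivial stabilizer.

Without coefficients the upper cluster algebra is generated by the initial cluster and
`M = (x₁² + x₂² + x₃²) / (x₁ x₂ x₃)`, as one sees by comparing denominators over `ℂ[M, x₂, x₃]`,
over which the algebra generated by these is free of rank two. Sign changes of the cluster multiply
`M` by the product of the signs. At a deep point either all three coordinates vanish, and flipping
two signs fixes the point, or exactly one coordinate and `M` vanish, and flipping one sign does. -/

namespace ClusterAlg

open MvPolynomial

section FieldGenerators

open scoped IntermediateField.algebraAdjoinAdjoin in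
theorem algebraicIndependent_of_isAlgebraic_adjoin {F E ι : Type*} [Field F] [Field E]
    [Algebra F E] [Finite ι] (v : ι → E)
    (hv : Algebra.IsAlgebraic (IntermediateField.adjoin F (Set.range v)) E)
    (htrdeg : Algebra.trdeg F E = Nat.card ι) : AlgebraicIndependent F v := by
  have : Algebra.IsAlgebraic (Algebra.adjoin F (Set.range v)) E :=
    (IsFractionRing.comap_isAlgebraic_iff (K := IntermediateField.adjoin F (Set.range v))).2 hv
  refine (Algebra.IsAlgebraic.isTranscendenceBasis_of_lift_le_trdeg_of_finite F v ?_).1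
  rw [htrdeg, ← Nat.cast_card (α := ι), Cardinal.lift_natCast, Cardinal.lift_natCast]

variable {n m : ℕ}

theorem trdeg_ratFun : Algebra.trdeg ℂ (RatFun n m) = ((n + m : ℕ) : Cardinal) := by
  have : Algebra.IsAlgebraic (MvPolynomial (Fin n ⊕ Fin m) ℂ) (RatFun n m) :=
    IsLocalization.isAlgebraic _ (nonZeroDivisors (MvPolynomial (Fin n ⊕ Fin m) ℂ))
  rw [← ((IsTranscendenceBasis.mvPolynomial (Fin n ⊕ Fin m) ℂ).algebraMap_comp
    (A := RatFun n m)).cardinalMk_eq_trdeg]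
  simp

theorem algebraicIndependent_of_adjoin_eq_top {v : Fin n ⊕ Fin m → RatFun n m}
    (hv : IntermediateField.adjoin ℂ (Set.range v) = ⊤) : AlgebraicIndependent ℂ v := by
  refine algebraicIndependent_of_isAlgebraic_adjoin v ?_ (by rw [trdeg_ratFun]; simp)
  exact ⟨fun z => isAlgebraic_algebraMap
    (⟨z, hv ▸ IntermediateField.mem_top⟩ : IntermediateField.adjoin ℂ (Set.range v))⟩

theorem coe_aeval_mk {F E ι : Type*} [CommSemiring F] [CommSemiring E] [Algebra F E]
    {S : Subalgebra F E} {v : ι → E} (hv : ∀ i, v i ∈ S) (p : MvPolynomial ι F) :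
    ((aeval (fun i => (⟨v i, hv i⟩ : S)) p : S) : E) = aeval v p :=
  (S.mvPolynomial_aeval_coe (fun i => ⟨v i, hv i⟩) p).symm

theorem aeval_mem {F E ι : Type*} [CommSemiring F] [CommSemiring E] [Algebra F E]
    {S : Subalgebra F E} {v : ι → E} (hv : ∀ i, v i ∈ S) (p : MvPolynomial ι F) :
    aeval v p ∈ S :=
  coe_aeval_mk hv p ▸ SetLike.coe_mem _

theorem aeval_initialSeed_var (B : Matrix (Fin n ⊕ Fin m) (Fin n) ℤ)
    (p : MvPolynomial (Fin n ⊕ Fin m) ℂ) :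
    aeval (initialSeed B).var p = algebraMap _ (RatFun n m) p :=
  (aeval_algebraMap_apply (RatFun n m) X p).trans (by rw [aeval_X_left_apply])

theorem adjoin_initialSeed_eq_top (B : Matrix (Fin n ⊕ Fin m) (Fin n) ℤ) :
    IntermediateField.adjoin ℂ (Set.range (initialSeed B).var) = ⊤ := by
  refine eq_top_iff.2 fun z _ => ?_
  have hpoly (p) : algebraMap (MvPolynomial (Fin n ⊕ Fin m) ℂ) (RatFun n m) p ∈
      IntermediateField.adjoin ℂ (Set.range (initialSeed B).var) := by
    rw [← aeval_initialSeed_var B]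
    exact aeval_mem (S := IntermediateField.toSubalgebra _)
      (fun i => IntermediateField.subset_adjoin ℂ _ (Set.mem_range_self i)) p
  obtain ⟨p, q, -, rfl⟩ := IsFractionRing.div_surjective (MvPolynomial (Fin n ⊕ Fin m) ℂ) z
  exact div_mem (hpoly p) (hpoly q)

end FieldGenerators

section Mutation

/-- The monomial in `y` whose exponents are the positive parts of the entries of `b`. -/
def posMonomial {ι A : Type*} [Fintype ι] [CommMonoid A] (y : ι → A) (b : ι → ℤ) : A :=
  ∏ i, y i ^ (b i).toNat

theorem map_posMonomial {ι A A' F : Type*} [Fintype ι] [CommMonoid A] [CommMonoid A']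
    [FunLike F A A'] [MonoidHomClass F A A'] (f : F) (y : ι → A) (b : ι → ℤ) :
    f (posMonomial y b) = posMonomial (fun i => f (y i)) b := by
  simp only [posMonomial, map_prod, map_pow]

theorem posMonomial_ne_zero {ι A : Type*} [Fintype ι] [CommMonoidWithZero A] [Nontrivial A]
    [NoZeroDivisors A] {y : ι → A} (hy : ∀ i, y i ≠ 0) (b : ι → ℤ) : posMonomial y b ≠ 0 :=
  Finset.prod_ne_zero_iff.2 fun i _ => pow_ne_zero _ (hy i)

variable {n m : ℕ}

/-- The right-hand side `∏ xᵢ ^ [bᵢₖ]₊ + ∏ xᵢ ^ [-bᵢₖ]₊` of the exchange relation in the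
direction `k`. -/
noncomputable def exchangeBinomial (M : Matrix (Fin n ⊕ Fin m) (Fin n) ℤ) (k : Fin n) :
    MvPolynomial (Fin n ⊕ Fin m) ℂ :=
  posMonomial X (fun i => M i k) + posMonomial X (fun i => -M i k)

theorem aeval_exchangeBinomial {A : Type*} [CommSemiring A] [Algebra ℂ A]
    (v : Fin n ⊕ Fin m → A) (M : Matrix (Fin n ⊕ Fin m) (Fin n) ℤ) (k : Fin n) :
    aeval v (exchangeBinomial M k) =
      posMonomial v (fun i => M i k) + posMonomial v (fun i => -M i k) := by
  simp only [exchangeBinomial, map_add, map_posMonomial, aeval_X]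

theorem exchangeBinomial_ne_zero (M : Matrix (Fin n ⊕ Fin m) (Fin n) ℤ) (k : Fin n) :
    exchangeBinomial M k ≠ 0 := by
  intro h
  have h1 := congrArg (aeval fun _ => (1 : ℂ)) h
  simp [aeval_exchangeBinomial, posMonomial] at h1

theorem aeval_exchangeBinomial_congr {A : Type*} [CommSemiring A] [Algebra ℂ A]
    {M : Matrix (Fin n ⊕ Fin m) (Fin n) ℤ} {k : Fin n} (hM : M (Sum.inl k) k = 0)
    {v w : Fin n ⊕ Fin m → A} (hvw : ∀ i, i ≠ Sum.inl k → v i = w i) :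
    aeval v (exchangeBinomial M k) = aeval w (exchangeBinomial M k) := by
  have hpow (i) (a : ℕ) (ha : i = Sum.inl k → a = 0) : v i ^ a = w i ^ a := by
    by_cases hi : i = Sum.inl k
    · rw [ha hi, pow_zero, pow_zero]
    · rw [hvw i hi]
  rw [aeval_exchangeBinomial, aeval_exchangeBinomial]
  congr 1 <;> exact Finset.prod_congr rfl fun i _ => hpow i _ (by rintro rfl; simp [hM])

theorem exchangeBinomial_mutateMatrix (M : Matrix (Fin n ⊕ Fin m) (Fin n) ℤ) (k : Fin n) :
    exchangeBinomial (mutateMatrix M k) k = exchangeBinomial M k := by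
  simp [exchangeBinomial, mutateMatrix, add_comm]

theorem mutateMatrix_mutateMatrix (M : Matrix (Fin n ⊕ Fin m) (Fin n) ℤ) (k : Fin n) :
    mutateMatrix (mutateMatrix M k) k = M := by
  ext i j
  by_cases h : i = Sum.inl k ∨ j = k
  · simp [mutateMatrix, h]
  · obtain ⟨hi, hj⟩ := not_or.1 h
    simp [mutateMatrix, hi, hj]

theorem Seed.mutate_var_of_ne (t : Seed n m) (k : Fin n) {i : Fin n ⊕ Fin m}
    (hi : i ≠ Sum.inl k) : (t.mutate k).var i = t.var i :=
  Function.update_of_ne hi _ _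

theorem Seed.mutate_var_self (t : Seed n m) (k : Fin n) :
    (t.mutate k).var (Sum.inl k) =
      (t.var (Sum.inl k))⁻¹ * aeval t.var (exchangeBinomial t.mat k) := by
  rw [aeval_exchangeBinomial]
  exact Function.update_self _ _ _

theorem Seed.mutate_mutate {t : Seed n m} {k : Fin n} (hk : t.mat (Sum.inl k) k = 0)
    (ht : AlgebraicIndependent ℂ t.var) : (t.mutate k).mutate k = t := by
  refine Seed.ext (funext fun i => ?_) (mutateMatrix_mutateMatrix _ k)
  by_cases hi : i = Sum.inl k
  · have hbinomial : aeval (t.mutate k).var (exchangeBinomial (t.mutate k).mat k) =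
        aeval t.var (exchangeBinomial t.mat k) :=
      (congrArg _ (exchangeBinomial_mutateMatrix _ _)).trans
        (aeval_exchangeBinomial_congr hk fun _ => t.mutate_var_of_ne k)
    have hne : aeval t.var (exchangeBinomial t.mat k) ≠ 0 :=
      (map_ne_zero_iff _ ht).2 (exchangeBinomial_ne_zero _ _)
    rw [hi, Seed.mutate_var_self, hbinomial, t.mutate_var_self, mul_inv, inv_inv,
      inv_mul_cancel_right₀ hne]
  · rw [Seed.mutate_var_of_ne _ k hi, Seed.mutate_var_of_ne _ k hi]

/-- The principal part of `M` is skew-symmetric. -/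
def HasSkewPrincipalPart (M : Matrix (Fin n ⊕ Fin m) (Fin n) ℤ) : Prop :=
  ∀ i j, M (Sum.inl i) j = -M (Sum.inl j) i

theorem HasSkewPrincipalPart.apply_self {M : Matrix (Fin n ⊕ Fin m) (Fin n) ℤ}
    (hM : HasSkewPrincipalPart M) (k : Fin n) : M (Sum.inl k) k = 0 :=
  self_eq_neg.1 (hM k k)

theorem HasSkewPrincipalPart.mutateMatrix {M : Matrix (Fin n ⊕ Fin m) (Fin n) ℤ}
    (hM : HasSkewPrincipalPart M) (k : Fin n) : HasSkewPrincipalPart (mutateMatrix M k) := by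
  intro i j
  simp only [ClusterAlg.mutateMatrix, Sum.inl.injEq, or_comm (a := i = k)]
  split_ifs
  · rw [hM i j]
  · rw [hM i j, hM i k, hM k j]
    simp only [neg_neg]
    ring

theorem Seed.mutate_var_mem (t : Seed n m) (k : Fin n) {K : IntermediateField ℂ (RatFun n m)}
    (hK : ∀ i, t.var i ∈ K) (i : Fin n ⊕ Fin m) : (t.mutate k).var i ∈ K := by
  by_cases hi : i = Sum.inl k
  · rw [hi, t.mutate_var_self]
    exact mul_mem (inv_mem (hK _)) (aeval_mem (S := K.toSubalgebra) hK _)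
  · rw [t.mutate_var_of_ne k hi]
    exact hK i

variable {B : Matrix (Fin n ⊕ Fin m) (Fin n) ℤ} {t : Seed n m}

theorem IsSeed.hasSkewPrincipalPart (ht : IsSeed B t) (hB : HasSkewPrincipalPart B) :
    HasSkewPrincipalPart t.mat := by
  induction ht with
  | initial => exact hB
  | mutate t k _ ih => exact ih.mutateMatrix k

theorem IsSeed.adjoin_eq_top (ht : IsSeed B t) (hB : HasSkewPrincipalPart B) :
    IntermediateField.adjoin ℂ (Set.range t.var) = ⊤ := by
  induction ht with
  | initial => exact adjoin_initialSeed_eq_top B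
  | mutate t k ht ih =>
    have hmem := (t.mutate k).mutate_var_mem k
      fun i => IntermediateField.subset_adjoin ℂ _ (Set.mem_range_self i)
    rw [Seed.mutate_mutate ((ht.hasSkewPrincipalPart hB).apply_self k)
      (algebraicIndependent_of_adjoin_eq_top ih)] at hmem
    rw [eq_top_iff, ← ih, IntermediateField.adjoin_le_iff]
    exact Set.range_subset_iff.2 hmem

theorem IsSeed.algebraicIndependent (ht : IsSeed B t) (hB : HasSkewPrincipalPart B) :
    AlgebraicIndependent ℂ t.var :=
  algebraicIndependent_of_adjoin_eq_top (ht.adjoin_eq_top hB)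

theorem IsSeed.var_ne_zero (ht : IsSeed B t) (hB : HasSkewPrincipalPart B) (i) : t.var i ≠ 0 :=
  (ht.algebraicIndependent hB).ne_zero i

theorem IsSeed.mutate_mutate (ht : IsSeed B t) (hB : HasSkewPrincipalPart B) (k : Fin n) :
    (t.mutate k).mutate k = t :=
  Seed.mutate_mutate ((ht.hasSkewPrincipalPart hB).apply_self k) (ht.algebraicIndependent hB)

theorem IsSeed.var_mul_mutate_var (ht : IsSeed B t) (hB : HasSkewPrincipalPart B) (k : Fin n) :
    t.var (Sum.inl k) * (t.mutate k).var (Sum.inl k) =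
      aeval t.var (exchangeBinomial t.mat k) := by
  rw [t.mutate_var_self, mul_inv_cancel_left₀ (ht.var_ne_zero hB _)]

theorem IsSeed.frozen_ne_zero (ht : IsSeed B t) (a : Fin m) : t.var (Sum.inr a) ≠ 0 := by
  rw [ht.var_inr]
  simp [initialSeed]

theorem IsSeed.algHom_ext (ht : IsSeed B t) (hB : HasSkewPrincipalPart B) {K : Type*} [Field K]
    [Algebra ℂ K] {σ τ : RatFun n m →ₐ[ℂ] K} (h : ∀ i, σ (t.var i) = τ (t.var i)) : σ = τ := by
  have htop : σ.comp (⊤ : IntermediateField ℂ (RatFun n m)).val =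
      τ.comp (⊤ : IntermediateField ℂ (RatFun n m)).val :=
    IntermediateField.algHom_ext_of_eq_adjoin _ (ht.adjoin_eq_top hB).symm
      (by rintro _ ⟨i, rfl⟩; exact h i)
  exact AlgHom.ext fun z => DFunLike.congr_fun htop ⟨z, IntermediateField.mem_top⟩

end Mutation

section LaurentRing

variable {n m : ℕ}

theorem var_mem_laurentRing (t : Seed n m) (i) : t.var i ∈ laurentRing t :=
  Algebra.subset_adjoin (Or.inl ⟨i, rfl⟩)

theorem var_inv_mem_laurentRing (t : Seed n m) (i) : (t.var i)⁻¹ ∈ laurentRing t :=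
  Algebra.subset_adjoin (Or.inr ⟨i, rfl⟩)

theorem exists_mul_prod_pow_eq_aeval {t : Seed n m} (h0 : ∀ i, t.var i ≠ 0) {f : RatFun n m}
    (hf : f ∈ laurentRing t) :
    ∃ (N : ℕ) (g : MvPolynomial (Fin n ⊕ Fin m) ℂ), f * (∏ i, t.var i) ^ N = aeval t.var g := by
  have hX : aeval t.var (∏ i, X i : MvPolynomial (Fin n ⊕ Fin m) ℂ) = ∏ i, t.var i := by
    simp only [map_prod, aeval_X]
  induction hf using Algebra.adjoin_induction with
  | mem x hx =>
    rcases hx with ⟨i, rfl⟩ | ⟨i, rfl⟩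
    · exact ⟨0, X i, by simp⟩
    · refine ⟨1, ∏ j ∈ Finset.univ.erase i, X j, ?_⟩
      rw [pow_one, ← Finset.mul_prod_erase Finset.univ t.var (Finset.mem_univ i),
        inv_mul_cancel_left₀ (h0 i), map_prod]
      simp only [aeval_X]
  | algebraMap a => exact ⟨0, C a, by simp⟩
  | add x y _ _ hx hy =>
    obtain ⟨N, g, hg⟩ := hx
    obtain ⟨N', g', hg'⟩ := hy
    refine ⟨N + N', g * (∏ i, X i) ^ N' + g' * (∏ i, X i) ^ N, ?_⟩
    rw [map_add, map_mul, map_mul, map_pow, map_pow, hX, ← hg, ← hg']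
    ring
  | mul x y _ _ hx hy =>
    obtain ⟨N, g, hg⟩ := hx
    obtain ⟨N', g', hg'⟩ := hy
    refine ⟨N + N', g * g', ?_⟩
    rw [map_mul, ← hg, ← hg']
    ring

/-- Evaluation at the extended cluster makes the Laurent ring of `t` an algebra over the polynomial
ring, of which it is a localization. -/
noncomputable instance algebraLaurentRing (t : Seed n m) :
    Algebra (MvPolynomial (Fin n ⊕ Fin m) ℂ) (laurentRing t) :=
  (aeval fun i => (⟨t.var i, var_mem_laurentRing t i⟩ : laurentRing t)).toAlgebra

instance isScalarTower_laurentRing (t : Seed n m) :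
    IsScalarTower ℂ (MvPolynomial (Fin n ⊕ Fin m) ℂ) (laurentRing t) :=
  IsScalarTower.of_algHom _

theorem coe_algebraMap_laurentRing (t : Seed n m) (g : MvPolynomial (Fin n ⊕ Fin m) ℂ) :
    (algebraMap _ (laurentRing t) g : RatFun n m) = aeval t.var g :=
  coe_aeval_mk (var_mem_laurentRing t) g

theorem algebraMap_laurentRing_X (t : Seed n m) (i : Fin n ⊕ Fin m) :
    algebraMap _ (laurentRing t) (X i : MvPolynomial (Fin n ⊕ Fin m) ℂ) =
      ⟨t.var i, var_mem_laurentRing t i⟩ :=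
  aeval_X _ i

theorem isLocalizationAway_laurentRing {t : Seed n m} (ht : AlgebraicIndependent ℂ t.var) :
    IsLocalization.Away (∏ i, X i : MvPolynomial (Fin n ⊕ Fin m) ℂ) (laurentRing t) := by
  have h0 (i) : t.var i ≠ 0 := ht.ne_zero i
  have hP : aeval t.var (∏ i, X i : MvPolynomial (Fin n ⊕ Fin m) ℂ) = ∏ i, t.var i := by
    simp only [map_prod, aeval_X]
  refine IsLocalization.Away.mk _ ?_ (fun ⟨f, hf⟩ => ?_) fun a b hab => ⟨0, ?_⟩
  · rw [map_prod]
    refine IsUnit.prod_univ_iff.2 fun i => .of_mul_eq_one ⟨_, var_inv_mem_laurentRing t i⟩ ?_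
    rw [algebraMap_laurentRing_X]
    exact Subtype.ext (mul_inv_cancel₀ (h0 i))
  · obtain ⟨N, g, hg⟩ := exists_mul_prod_pow_eq_aeval h0 hf
    refine ⟨N, g, Subtype.ext ?_⟩
    simp only [MulMemClass.coe_mul, SubmonoidClass.coe_pow, coe_algebraMap_laurentRing, hP, hg]
  · rw [Subtype.ext_iff, coe_algebraMap_laurentRing, coe_algebraMap_laurentRing] at hab
    rw [ht hab]

theorem exists_laurentRing_algHom {t : Seed n m} (ht : AlgebraicIndependent ℂ t.var)
    {K : Type*} [Field K] [Algebra ℂ K] {c : Fin n ⊕ Fin m → K} (hc : ∀ i, c i ≠ 0) :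
    ∃ q : laurentRing t →ₐ[ℂ] K, ∀ i, q ⟨t.var i, var_mem_laurentRing t i⟩ = c i := by
  have := isLocalizationAway_laurentRing ht
  have hunit : IsUnit (aeval c (∏ i, X i : MvPolynomial (Fin n ⊕ Fin m) ℂ)) := by
    simpa [map_prod, Finset.prod_ne_zero_iff] using hc
  refine ⟨IsLocalization.liftAlgHom (M := .powers (∏ i, X i)) (f := aeval c) ?_, fun i => ?_⟩
  · rintro ⟨_, N, rfl⟩
    simpa only [map_pow] using hunit.pow N
  · rw [← algebraMap_laurentRing_X, IsLocalization.liftAlgHom_apply, IsLocalization.lift_eq]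
    exact aeval_X c i

theorem map_aeval_mk {F E K ι : Type*} [CommSemiring F] [CommSemiring E] [Algebra F E]
    [CommSemiring K] [Algebra F K] {S : Subalgebra F E} {v : ι → E} (hv : ∀ i, v i ∈ S)
    (p : S →ₐ[F] K) (g : MvPolynomial ι F) :
    p ⟨aeval v g, aeval_mem hv g⟩ = aeval (fun i => p ⟨v i, hv i⟩) g := by
  refine .trans (congrArg p ?_) (comp_aeval_apply _ p g)
  exact Subtype.ext (coe_aeval_mk hv g).symm

theorem map_mul_prod_pow {F E K ι : Type*} [Fintype ι] [CommSemiring F] [CommSemiring E]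
    [Algebra F E] [CommSemiring K] [Algebra F K] {S : Subalgebra F E} {v : ι → E}
    (hv : ∀ i, v i ∈ S) {f : E} (hf : f ∈ S) {N : ℕ} {g : MvPolynomial ι F}
    (hg : f * (∏ i, v i) ^ N = aeval v g) (p : S →ₐ[F] K) :
    p ⟨f, hf⟩ * (∏ i, p ⟨v i, hv i⟩) ^ N = aeval (fun i => p ⟨v i, hv i⟩) g := by
  rw [← map_aeval_mk, ← map_prod, ← map_pow, ← map_mul]
  congr 1
  exact Subtype.ext (by simp [← hg])

theorem algHom_apply_eq_of_mem_laurentRing {t : Seed n m} (h0 : ∀ i, t.var i ≠ 0)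
    {K : Type*} [Field K] [Algebra ℂ K] {R R' : Subalgebra ℂ (RatFun n m)}
    (hR : ∀ i, t.var i ∈ R) (hR' : ∀ i, t.var i ∈ R') {p : R →ₐ[ℂ] K} {q : R' →ₐ[ℂ] K}
    (hpq : ∀ i, p ⟨t.var i, hR i⟩ = q ⟨t.var i, hR' i⟩) (hp : ∀ i, p ⟨t.var i, hR i⟩ ≠ 0)
    {f : RatFun n m} (hf : f ∈ laurentRing t) (hfR : f ∈ R) (hfR' : f ∈ R') :
    p ⟨f, hfR⟩ = q ⟨f, hfR'⟩ := by
  obtain ⟨N, g, hg⟩ := exists_mul_prod_pow_eq_aeval h0 hf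
  have hprod : ∏ i, p ⟨t.var i, hR i⟩ ≠ 0 := Finset.prod_ne_zero_iff.2 fun i _ => hp i
  refine mul_right_cancel₀ (pow_ne_zero N hprod) ?_
  rw [map_mul_prod_pow hR hfR hg p]
  simp only [hpq]
  rw [map_mul_prod_pow hR' hfR' hg q]

theorem mem_clusterTorus_iff {t : Seed n m} (ht : AlgebraicIndependent ℂ t.var)
    {R : Subalgebra ℂ (RatFun n m)} (hR : ∀ i, t.var i ∈ R) (p : Points R) :
    p ∈ clusterTorus R t ↔ ∀ i, p ⟨t.var i, hR i⟩ ≠ 0 := by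
  have h0 (i) : t.var i ≠ 0 := ht.ne_zero i
  constructor
  · rintro ⟨q, hq⟩ i
    have hunit : IsUnit (⟨t.var i, var_mem_laurentRing t i⟩ : laurentRing t) :=
      .of_mul_eq_one ⟨_, var_inv_mem_laurentRing t i⟩ (Subtype.ext (mul_inv_cancel₀ (h0 i)))
    rw [hq _ _ (var_mem_laurentRing t i)]
    exact (hunit.map q).ne_zero
  · intro hp
    obtain ⟨q, hq⟩ := exists_laurentRing_algHom ht hp
    exact ⟨q, fun f hf hL => algHom_apply_eq_of_mem_laurentRing h0 hR (var_mem_laurentRing t)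
      (fun i => (hq i).symm) hp hL hf hL⟩

end LaurentRing

section ClusterAutomorphisms

variable {n m : ℕ} {B : Matrix (Fin n ⊕ Fin m) (Fin n) ℤ}

/-- `ρ` is the restriction to `R` of the action of the cluster automorphisms on `ℱ`. -/
def IsRestrictedAction {R : Subalgebra ℂ (RatFun n m)} (ρ : clusterAut B →* (R ≃ₐ[ℂ] R)) : Prop :=
  ∀ φ (r : R), ((ρ φ r : R) : RatFun n m) = fieldAut B φ r

theorem isRestrictedAction_clusterAction : IsRestrictedAction (clusterAction B) :=
  fun φ r => (fieldAut_coe φ r).symm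

theorem isRestrictedAction_upperAction : IsRestrictedAction (upperAction B) :=
  fun _ _ => rfl

theorem exists_fieldAut_eq_smul (φ : clusterAut B) {z : RatFun n m}
    (hz : z ∈ clusterVariables B ∪ frozenVariables B) :
    ∃ ζ : ℂ, ζ ≠ 0 ∧ fieldAut B φ z = ζ • z := by
  obtain ⟨ζ, hζ, h⟩ := φ.2 ⟨z, Algebra.subset_adjoin (Or.inl hz)⟩ hz
  exact ⟨ζ, hζ, (fieldAut_coe φ ⟨z, _⟩).trans (congrArg Subtype.val h)⟩

theorem fieldAut_injective : Function.Injective (fieldAut B) := fun φ ψ h =>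
  Subtype.ext (AlgEquiv.ext fun a => Subtype.ext (by rw [← fieldAut_coe, h, fieldAut_coe]))

theorem IsSeed.eq_one_of_forall_fieldAut_eq {t : Seed n m} (ht : IsSeed B t)
    (hB : HasSkewPrincipalPart B) {φ : clusterAut B}
    (h : ∀ i, fieldAut B φ (t.var i) = t.var i) : φ = 1 := by
  have hid : AlgHomClass.toAlgHom (fieldAut B φ) = AlgHom.id ℂ (RatFun n m) := ht.algHom_ext hB h
  refine fieldAut_injective (AlgEquiv.ext fun z => ?_)
  rw [map_one]
  exact DFunLike.congr_fun hid z

theorem ne_one_of_fieldAut_eq_smul {φ : clusterAut B} {z : RatFun n m} {c : ℂ}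
    (hφ : fieldAut B φ z = c • z) (hz : z ≠ 0) (hc : c ≠ 1) : φ ≠ 1 := by
  rintro rfl
  rw [map_one, AlgEquiv.one_apply] at hφ
  exact hc (smul_left_injective ℂ hz (by simpa using hφ.symm))

theorem map_clusterAlgebra_le {σ : RatFun n m ≃ₐ[ℂ] RatFun n m}
    (hσ : ∀ z ∈ clusterVariables B ∪ frozenVariables B, ∃ ζ : ℂ, σ z = ζ • z) :
    (clusterAlgebra B).map σ.toAlgHom ≤ clusterAlgebra B := by
  rw [Subalgebra.map_le]
  refine Algebra.adjoin_le ?_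
  intro z hz
  have hzA : z ∈ clusterAlgebra B := Algebra.subset_adjoin hz
  change σ z ∈ clusterAlgebra B
  rcases hz with hz | hz
  · obtain ⟨ζ, h⟩ := hσ z hz
    rw [h]
    exact Subalgebra.smul_mem _ hzA ζ
  · obtain ⟨ζ, h⟩ := hσ z⁻¹ (Or.inr hz)
    have h' : σ z = algebraMap ℂ (RatFun n m) ζ⁻¹ * z := by
      rw [← inv_inv (σ z), ← map_inv₀, h, Algebra.smul_def, mul_inv, inv_inv, map_inv₀]
    rw [h']
    exact mul_mem (Subalgebra.algebraMap_mem _ _) hzA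

theorem exists_clusterAut_fieldAut_eq {σ : RatFun n m ≃ₐ[ℂ] RatFun n m}
    (hσ : ∀ z ∈ clusterVariables B ∪ frozenVariables B, ∃ ζ : ℂ, ζ ≠ 0 ∧ σ z = ζ • z) :
    ∃ φ : clusterAut B, fieldAut B φ = σ := by
  have hle : (clusterAlgebra B).map σ.toAlgHom ≤ clusterAlgebra B :=
    map_clusterAlgebra_le fun z hz => (hσ z hz).imp fun _ h => h.2
  have hle' : (clusterAlgebra B).map σ.symm.toAlgHom ≤ clusterAlgebra B := by
    refine map_clusterAlgebra_le fun z hz => ?_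
    obtain ⟨ζ, hζ, h⟩ := hσ z hz
    refine ⟨ζ⁻¹, σ.symm_apply_eq.2 ?_⟩
    rw [Algebra.smul_def, map_mul, AlgEquiv.commutes, h, ← Algebra.smul_def, inv_smul_smul₀ hζ]
  let e : clusterAlgebra B ≃ₐ[ℂ] clusterAlgebra B := AlgEquiv.ofAlgHom
    ((σ.toAlgHom.comp (clusterAlgebra B).val).codRestrict _ fun z => hle ⟨z, z.2, rfl⟩)
    ((σ.symm.toAlgHom.comp (clusterAlgebra B).val).codRestrict _ fun z => hle' ⟨z, z.2, rfl⟩)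
    (AlgHom.ext fun z => Subtype.ext (σ.apply_symm_apply z))
    (AlgHom.ext fun z => Subtype.ext (σ.symm_apply_apply z))
  have he : e ∈ clusterAut B := fun z hz => by
    obtain ⟨ζ, hζ, h⟩ := hσ z hz
    exact ⟨ζ, hζ, Subtype.ext h⟩
  refine ⟨⟨e, he⟩, AlgEquiv.ext fun z => ?_⟩
  obtain ⟨a, b, -, rfl⟩ := IsFractionRing.div_surjective (clusterAlgebra B) z
  rw [map_div₀, map_div₀]
  exact congrArg₂ _ (fieldAut_coe _ a) (fieldAut_coe _ b)

theorem exists_rescaling (B : Matrix (Fin n ⊕ Fin m) (Fin n) ℤ) {c : Fin n ⊕ Fin m → ℂ}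
    (hc : ∀ i, c i ≠ 0) : ∃ σ : RatFun n m ≃ₐ[ℂ] RatFun n m,
      ∀ i, σ ((initialSeed B).var i) = c i • (initialSeed B).var i := by
  let e : MvPolynomial (Fin n ⊕ Fin m) ℂ ≃ₐ[ℂ] MvPolynomial (Fin n ⊕ Fin m) ℂ :=
    AlgEquiv.ofAlgHom (aeval fun i => c i • X i) (aeval fun i => (c i)⁻¹ • X i)
      (by ext1 i; simp [smul_smul, hc]) (by ext1 i; simp [smul_smul, hc])
  refine ⟨IsFractionRing.fieldEquivOfAlgEquiv ℂ _ _ e, fun i => ?_⟩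
  refine (IsFractionRing.fieldEquivOfAlgEquiv_algebraMap ℂ _ _ e (X i)).trans ?_
  have he : e (X i) = c i • X i := aeval_X _ i
  rw [he, Algebra.smul_def, map_mul, ← IsScalarTower.algebraMap_apply, ← Algebra.smul_def]
  rfl

end ClusterAutomorphisms

section Stabilizers

variable {n m : ℕ} {B : Matrix (Fin n ⊕ Fin m) (Fin n) ℤ} {R : Subalgebra ℂ (RatFun n m)}
  {ρ : clusterAut B →* (R ≃ₐ[ℂ] R)}

theorem IsRestrictedAction.apply_eq_smul (hρ : IsRestrictedAction ρ) {φ : clusterAut B} {r : R}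
    {c : ℂ} (h : fieldAut B φ r = c • (r : RatFun n m)) : ρ φ r = c • r :=
  Subtype.ext ((hρ φ r).trans h)

theorem eq_one_of_mem_pointStabilizer (hρ : IsRestrictedAction ρ) {φ : clusterAut B}
    {p : Points R} (hφ : φ ∈ pointStabilizer ρ p) {r : R} {c : ℂ}
    (h : fieldAut B φ r = c • (r : RatFun n m)) (hpr : p r ≠ 0) : c = 1 := by
  have hfix : c * p r = 1 * p r := by
    rw [one_mul, ← smul_eq_mul, ← map_smul, ← hρ.apply_eq_smul h]
    exact hφ r
  exact mul_right_cancel₀ hpr hfix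

theorem mem_pointStabilizer_of_adjoin_eq (hρ : IsRestrictedAction ρ) {G : Set (RatFun n m)}
    (hG : Algebra.adjoin ℂ G = R) {φ : clusterAut B} {p : Points R}
    (h : ∀ (z : RatFun n m) (hz : z ∈ R), z ∈ G →
      ∃ c : ℂ, fieldAut B φ z = c • z ∧ (c = 1 ∨ p ⟨z, hz⟩ = 0)) :
    φ ∈ pointStabilizer ρ p := by
  subst hG
  suffices hp : p.comp (ρ φ).toAlgHom = p from fun r => DFunLike.congr_fun hp r
  refine AlgHom.adjoin_ext fun z hz => ?_
  have hz' := Algebra.subset_adjoin (R := ℂ) hz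
  obtain ⟨c, hc, hpc⟩ := h z hz' hz
  have hsmul : ρ φ ⟨z, hz'⟩ = c • ⟨z, hz'⟩ := hρ.apply_eq_smul hc
  refine (congrArg p hsmul).trans ((map_smul p c ⟨z, hz'⟩).trans ?_)
  rcases hpc with rfl | h0
  · exact one_smul ℂ _
  · exact (congrArg (c • ·) h0).trans ((smul_zero c).trans h0.symm)

theorem stabilizerLocus_subset_deepLocus (hB : HasSkewPrincipalPart B) (hR : clusterAlgebra B ≤ R)
    (hρ : IsRestrictedAction ρ) : stabilizerLocus ρ ⊆ deepLocus B R := by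
  intro p hp t ht htorus
  have hmem (i) : t.var i ∈ R := hR (ht.var_mem_clusterAlgebra i)
  have hne := (mem_clusterTorus_iff (ht.algebraicIndependent hB) hmem p).1 htorus
  refine hp ((Subgroup.eq_bot_iff_forall _).2 fun φ hφ =>
    ht.eq_one_of_forall_fieldAut_eq hB fun i => ?_)
  obtain ⟨ζ, -, hζ⟩ := exists_fieldAut_eq_smul φ (ht.var_mem i)
  rw [hζ, eq_one_of_mem_pointStabilizer hρ hφ (r := ⟨t.var i, hmem i⟩) hζ (hne i), one_smul]

end Stabilizers

section Coordinates

variable {n m : ℕ} {B : Matrix (Fin n ⊕ Fin m) (Fin n) ℤ} {t : Seed n m}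

/-- The coordinates of a point of the spectrum of the cluster algebra in the extended cluster of a
seed. -/
noncomputable def IsSeed.coord (ht : IsSeed B t) (p : Points (clusterAlgebra B))
    (i : Fin n ⊕ Fin m) : ℂ :=
  p ⟨t.var i, ht.var_mem_clusterAlgebra i⟩

theorem IsSeed.coord_frozen_ne_zero (ht : IsSeed B t) (p : Points (clusterAlgebra B))
    (a : Fin m) : ht.coord p (Sum.inr a) ≠ 0 := by
  have hinv : (t.var (Sum.inr a))⁻¹ ∈ clusterAlgebra B :=
    Algebra.subset_adjoin (Or.inr ⟨a, by rw [inv_inv, ht.var_inr]⟩)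
  have hunit : IsUnit (⟨t.var (Sum.inr a), ht.var_mem_clusterAlgebra _⟩ : clusterAlgebra B) :=
    .of_mul_eq_one ⟨_, hinv⟩ (Subtype.ext (mul_inv_cancel₀ (ht.frozen_ne_zero a)))
  exact (hunit.map p).ne_zero

theorem IsSeed.coord_mutate_of_ne (ht : IsSeed B t) (p : Points (clusterAlgebra B)) {k : Fin n}
    {i : Fin n ⊕ Fin m} (hi : i ≠ Sum.inl k) :
    (IsSeed.mutate t k ht).coord p i = ht.coord p i :=
  congrArg p (Subtype.ext (t.mutate_var_of_ne k hi))

theorem IsSeed.coord_mul_coord_mutate (ht : IsSeed B t) (hB : HasSkewPrincipalPart B)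
    (p : Points (clusterAlgebra B)) (k : Fin n) :
    ht.coord p (Sum.inl k) * (IsSeed.mutate t k ht).coord p (Sum.inl k) =
      aeval (ht.coord p) (exchangeBinomial t.mat k) := by
  refine .trans ?_ (map_aeval_mk ht.var_mem_clusterAlgebra p (exchangeBinomial t.mat k))
  exact (map_mul p _ _).symm.trans (congrArg p (Subtype.ext (ht.var_mul_mutate_var hB k)))

theorem mem_deepLocus_clusterAlgebra_iff (hB : HasSkewPrincipalPart B)
    {p : Points (clusterAlgebra B)} : p ∈ deepLocus B (clusterAlgebra B) ↔
      ∀ (t : Seed n m) (ht : IsSeed B t), ∃ i, ht.coord p (Sum.inl i) = 0 := by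
  refine forall₂_congr fun t ht => ?_
  rw [mem_clusterTorus_iff (ht.algebraicIndependent hB) ht.var_mem_clusterAlgebra, not_forall]
  simp only [not_not, Sum.exists]
  exact or_iff_left fun ⟨a, ha⟩ => ht.coord_frozen_ne_zero p a ha

theorem comp_inclusion_mem_deepLocus_iff (hB : HasSkewPrincipalPart B)
    {R : Subalgebra ℂ (RatFun n m)} (hR : clusterAlgebra B ≤ R) {p : Points R} :
    p.comp (Subalgebra.inclusion hR) ∈ deepLocus B (clusterAlgebra B) ↔
      p ∈ deepLocus B R := by
  refine forall₂_congr fun t ht => not_congr ?_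
  rw [mem_clusterTorus_iff (ht.algebraicIndependent hB) ht.var_mem_clusterAlgebra,
    mem_clusterTorus_iff (ht.algebraicIndependent hB) fun i => hR (ht.var_mem_clusterAlgebra i)]
  rfl

end Coordinates

section Oriented

theorem fin_three_add_add (k s : Fin 3) : k + s + s = k - s := by
  revert k s; decide

theorem fin_three_sub_sub (k s : Fin 3) : k - s - s = k + s := by
  revert k s; decide

theorem fin_three_sub_ne_add {s : Fin 3} (hs : s ≠ 0) (k : Fin 3) : k - s ≠ k + s := by
  revert s k; decide

theorem eq_or_eq_add_or_eq_sub (i k : Fin 3) {s : Fin 3} (hs : s ≠ 0) :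
    i = k ∨ i = k + s ∨ i = k - s := by
  revert s i k; decide

theorem exists_ne_and_ne_fin_three (i k : Fin 3) : ∃ j, j ≠ i ∧ j ≠ k := by
  revert i k; decide

theorem prod_fin_three {A : Type*} [CommMonoid A] (f : Fin 3 → A) {s : Fin 3} (hs : s ≠ 0)
    (k : Fin 3) : ∏ i, f i = f k * f (k + s) * f (k - s) := by
  have hinj : Function.Injective ![k, k + s, k - s] := by revert s k; decide
  rw [← (Equiv.ofBijective _ (Finite.injective_iff_bijective.1 hinj)).prod_comp f,
    Fin.prod_univ_three]
  rfl

variable {m : ℕ} {M : Matrix (Fin 3 ⊕ Fin m) (Fin 3) ℤ} {s : Fin 3}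

/-- The principal part of `M` is the exchange matrix of the Markov quiver, whose pairs of parallel
arrows form an oriented triangle; the two possible orientations are distinguished by `s = ±1`. -/
def Oriented (M : Matrix (Fin 3 ⊕ Fin m) (Fin 3) ℤ) (s : Fin 3) : Prop :=
  s ≠ 0 ∧ ∀ k, M (Sum.inl k) k = 0 ∧ M (Sum.inl (k + s)) k = 2 ∧ M (Sum.inl (k - s)) k = -2

theorem oriented_of_toRows₁_eq (hM : M.toRows₁ = markovPrincipal) : Oriented M 1 := by
  have happly (i j) : M (Sum.inl i) j = markovPrincipal i j := congrFun (congrFun hM i) j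
  simp only [Oriented, happly]
  decide

theorem Oriented.hasSkewPrincipalPart (h : Oriented M s) : HasSkewPrincipalPart M := by
  intro i j
  obtain ⟨hii, hadd, hsub⟩ := h.2 i
  rcases eq_or_eq_add_or_eq_sub j i h.1 with rfl | rfl | rfl
  · rw [hii, neg_zero]
  · have := (h.2 (i + s)).2.2
    rw [add_sub_cancel_right] at this
    rw [hadd, this]
  · have := (h.2 (i - s)).2.1
    rw [sub_add_cancel] at this
    rw [hsub, this, neg_neg]

theorem Oriented.mutate (h : Oriented M s) (k : Fin 3) : Oriented (mutateMatrix M k) (-s) := by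
  obtain ⟨hs, h⟩ := h
  have hadd : k + s ≠ k := by simpa using hs
  have hsub : k - s ≠ k := by simpa using hs
  have hne := fin_three_sub_ne_add hs k
  obtain ⟨a0, b0, c0⟩ := h k
  obtain ⟨a1, b1, c1⟩ := h (k + s)
  obtain ⟨a2, b2, c2⟩ := h (k - s)
  rw [fin_three_add_add] at b1
  rw [add_sub_cancel_right] at c1
  rw [sub_add_cancel] at b2
  rw [fin_three_sub_sub] at c2
  refine ⟨neg_ne_zero.2 hs, fun j => ?_⟩
  rw [sub_neg_eq_add, ← sub_eq_add_neg]
  rcases eq_or_eq_add_or_eq_sub j k hs with rfl | rfl | rfl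
  · simp [mutateMatrix, a0, b0, c0]
  · rw [fin_three_add_add, add_sub_cancel_right]
    simp [mutateMatrix, b0, c0, a1, b1, c1, hadd, hsub]
  · rw [fin_three_sub_sub, sub_add_cancel]
    simp [mutateMatrix, b0, c0, a2, b2, c2, hadd, hsub]

theorem IsSeed.exists_oriented {B : Matrix (Fin 3 ⊕ Fin m) (Fin 3) ℤ} {t : Seed 3 m}
    (ht : IsSeed B t) (hB : Oriented B s) : ∃ s', Oriented t.mat s' := by
  induction ht with
  | initial => exact ⟨s, hB⟩
  | mutate t k _ ih => exact ih.imp' _ fun _ h => h.mutate k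

theorem Oriented.aeval_exchangeBinomial {A : Type*} [CommSemiring A] [Algebra ℂ A]
    (h : Oriented M s) (v : Fin 3 ⊕ Fin m → A) (k : Fin 3) :
    aeval v (exchangeBinomial M k) =
      posMonomial (fun a => v (Sum.inr a)) (fun a => M (Sum.inr a) k) * v (Sum.inl (k + s)) ^ 2 +
      posMonomial (fun a => v (Sum.inr a)) (fun a => -M (Sum.inr a) k) *
        v (Sum.inl (k - s)) ^ 2 := by
  obtain ⟨h0, hadd, hsub⟩ := h.2 k
  simp only [ClusterAlg.aeval_exchangeBinomial, posMonomial, Fintype.prod_sum_type,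
    prod_fin_three _ h.1 k, h0, hadd, hsub]
  simp [mul_comm]

end Oriented

section DeepPoints

variable {m : ℕ} {B : Matrix (Fin 3 ⊕ Fin m) (Fin 3) ℤ} {s : Fin 3} {t : Seed 3 m}
  {p : Points (clusterAlgebra B)}

theorem IsSeed.map_var_eq_sign_smul (ht : IsSeed B t) (hB : Oriented B s) {ε : Fin 3 → ℂ}
    (hε : ∀ i, ε i ^ 2 = 1) {σ : RatFun 3 m ≃ₐ[ℂ] RatFun 3 m}
    (hσ : ∀ i, σ ((initialSeed B).var i) = Sum.elim ε 1 i • (initialSeed B).var i)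
    (i : Fin 3 ⊕ Fin m) : σ (t.var i) = Sum.elim ε 1 i • t.var i := by
  induction ht generalizing i with
  | initial => exact hσ i
  | mutate t k ht ih =>
    obtain ⟨s', h⟩ := ht.exists_oriented hB
    have hfrozen (a) : σ (t.var (Sum.inr a)) = t.var (Sum.inr a) := by
      rw [ih, Sum.elim_inr, Pi.one_apply, one_smul]
    have hsq (j) : σ (t.var (Sum.inl j)) ^ 2 = t.var (Sum.inl j) ^ 2 := by
      rw [ih, Sum.elim_inl, Algebra.smul_def, mul_pow, ← map_pow, hε, map_one, one_mul]
    have hbinomial : σ (aeval t.var (exchangeBinomial t.mat k)) =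
        aeval t.var (exchangeBinomial t.mat k) := by
      simp only [h.aeval_exchangeBinomial, map_add, map_mul, map_pow, map_posMonomial, hfrozen, hsq]
    by_cases hi : i = Sum.inl k
    · have hinv : (ε k)⁻¹ = ε k := inv_eq_of_mul_eq_one_left (by rw [← sq, hε])
      rw [hi, t.mutate_var_self, map_mul, map_inv₀, hbinomial, ih, Sum.elim_inl, Algebra.smul_def,
        Algebra.smul_def, mul_inv, ← map_inv₀, hinv, mul_assoc]
    · rw [t.mutate_var_of_ne k hi, ih]

theorem Oriented.exists_clusterAut_sign (hB : Oriented B s) {ε : Fin 3 → ℂ}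
    (hε : ∀ i, ε i ^ 2 = 1) : ∃ φ : clusterAut B, ∀ (t : Seed 3 m), IsSeed B t →
      ∀ i, fieldAut B φ (t.var i) = Sum.elim ε 1 i • t.var i := by
  have hne (i : Fin 3 ⊕ Fin m) : (Sum.elim ε 1 i : ℂ) ≠ 0 := by
    rcases i with i | _
    · exact fun h => by simpa [show ε i = 0 from h] using hε i
    · exact one_ne_zero
  obtain ⟨σ, hσ⟩ := exists_rescaling B hne
  have hvar (t : Seed 3 m) (ht : IsSeed B t) := ht.map_var_eq_sign_smul hB hε hσ
  obtain ⟨φ, rfl⟩ : ∃ φ : clusterAut B, fieldAut B φ = σ := by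
    refine exists_clusterAut_fieldAut_eq ?_
    rintro _ (⟨t, ht, i, rfl⟩ | ⟨a, rfl⟩)
    · exact ⟨_, hne (Sum.inl i), hvar t ht _⟩
    · exact ⟨_, hne (Sum.inr a), hσ _⟩
  exact ⟨φ, hvar⟩

theorem IsSeed.coord_eq_zero_iff_of_mul_eq_zero (ht : IsSeed B t) (hB : Oriented B s) {k : Fin 3}
    (hk : ht.coord p (Sum.inl k) * (IsSeed.mutate t k ht).coord p (Sum.inl k) = 0) {i j : Fin 3}
    (hi : i ≠ k) (hj : j ≠ k) : ht.coord p (Sum.inl i) = 0 ↔ ht.coord p (Sum.inl j) = 0 := by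
  obtain ⟨s', h⟩ := ht.exists_oriented hB
  rw [ht.coord_mul_coord_mutate hB.hasSkewPrincipalPart, h.aeval_exchangeBinomial] at hk
  have hpos := posMonomial_ne_zero (ht.coord_frozen_ne_zero p) fun a => t.mat (Sum.inr a) k
  have hneg := posMonomial_ne_zero (ht.coord_frozen_ne_zero p) fun a => -t.mat (Sum.inr a) k
  have hiff : ht.coord p (Sum.inl (k + s')) = 0 ↔ ht.coord p (Sum.inl (k - s')) = 0 := by
    constructor <;> intro h0
    · simpa [h0, hneg] using hk
    · simpa [h0, hpos] using hk
  rcases (eq_or_eq_add_or_eq_sub i k h.1).resolve_left hi with rfl | rfl <;>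
    rcases (eq_or_eq_add_or_eq_sub j k h.1).resolve_left hj with rfl | rfl
  exacts [Iff.rfl, hiff, hiff.symm, Iff.rfl]

theorem IsSeed.coord_eq_zero_of_forall_ne_iff (ht : IsSeed B t) (hB : Oriented B s)
    (hp : p ∈ deepLocus B (clusterAlgebra B)) {k : Fin 3}
    (hk : ∀ i j, i ≠ k → j ≠ k → (ht.coord p (Sum.inl i) = 0 ↔ ht.coord p (Sum.inl j) = 0)) :
    ht.coord p (Sum.inl k) = 0 := by
  obtain ⟨i, hi⟩ := (mem_deepLocus_clusterAlgebra_iff hB.hasSkewPrincipalPart).1 hp t ht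
  rcases eq_or_ne k i with rfl | hki
  · exact hi
  · obtain ⟨j, hji, hjk⟩ := exists_ne_and_ne_fin_three i k
    have hj : ht.coord p (Sum.inl j) = 0 := (hk i j hki.symm hjk).1 hi
    have hmul : ht.coord p (Sum.inl i) * (IsSeed.mutate t i ht).coord p (Sum.inl i) = 0 := by
      rw [hi, zero_mul]
    exact (ht.coord_eq_zero_iff_of_mul_eq_zero hB hmul hji hki).1 hj

theorem IsSeed.coord_mutate_eq_zero_iff (ht : IsSeed B t) (hB : Oriented B s)
    (hp : p ∈ deepLocus B (clusterAlgebra B)) (k j : Fin 3) :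
    (IsSeed.mutate t k ht).coord p (Sum.inl j) = 0 ↔ ht.coord p (Sum.inl j) = 0 := by
  have hne {i} (hi : i ≠ k) : (IsSeed.mutate t k ht).coord p (Sum.inl i) =
      ht.coord p (Sum.inl i) := ht.coord_mutate_of_ne p (Sum.inl_injective.ne hi)
  rcases eq_or_ne j k with rfl | hj
  · refine ⟨fun h0 => ht.coord_eq_zero_of_forall_ne_iff hB hp fun i l hi hl => ?_,
      fun h0 => (IsSeed.mutate t j ht).coord_eq_zero_of_forall_ne_iff hB hp fun i l hi hl => ?_⟩
    · exact ht.coord_eq_zero_iff_of_mul_eq_zero hB (by rw [h0, mul_zero]) hi hl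
    · rw [hne hi, hne hl]
      exact ht.coord_eq_zero_iff_of_mul_eq_zero hB (by rw [h0, zero_mul]) hi hl
  · rw [hne hj]

theorem IsSeed.coord_eq_zero_iff (ht : IsSeed B t) (hB : Oriented B s)
    (hp : p ∈ deepLocus B (clusterAlgebra B)) (j : Fin 3) :
    ht.coord p (Sum.inl j) = 0 ↔ (IsSeed.initial (B := B)).coord p (Sum.inl j) = 0 := by
  induction ht with
  | initial => exact Iff.rfl
  | mutate t k ht ih => exact (ht.coord_mutate_eq_zero_iff hB hp k j).trans ih

theorem Oriented.clusterHasNoMysteriousPoints (hB : Oriented B s) :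
    ClusterHasNoMysteriousPoints B := by
  have hskew := hB.hasSkewPrincipalPart
  refine (stabilizerLocus_subset_deepLocus hskew le_rfl isRestrictedAction_clusterAction).antisymm
    fun p hp hbot => ?_
  obtain ⟨i, hi⟩ := (mem_deepLocus_clusterAlgebra_iff hskew).1 hp _ .initial
  have hε (j) : Function.update (1 : Fin 3 → ℂ) i (-1) j ^ 2 = 1 := by
    rcases eq_or_ne j i with rfl | hj <;> simp [*]
  obtain ⟨φ, hφ⟩ := hB.exists_clusterAut_sign hε
  have hφ1 : φ ≠ 1 := ne_one_of_fieldAut_eq_smul (hφ _ .initial (Sum.inl i))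
    (IsSeed.initial.var_ne_zero hskew _) (by simp; norm_num)
  refine hφ1 ((Subgroup.eq_bot_iff_forall _).1 hbot φ ?_)
  refine mem_pointStabilizer_of_adjoin_eq isRestrictedAction_clusterAction rfl ?_
  rintro z hz ((⟨t, ht, j, rfl⟩ | ⟨a, rfl⟩) | ⟨a, ha⟩)
  · refine ⟨_, hφ t ht _, ?_⟩
    rcases eq_or_ne j i with rfl | hj
    · exact Or.inr ((ht.coord_eq_zero_iff hB hp j).2 hi)
    · exact Or.inl (by simp [hj])
  · exact ⟨_, hφ _ .initial _, Or.inl rfl⟩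
  · have hfix := hφ _ .initial (Sum.inr a)
    simp only at ha
    rw [ha, map_inv₀, Sum.elim_inr, Pi.one_apply, one_smul, inv_inj] at hfix
    exact ⟨1, by rw [hfix, one_smul], Or.inl rfl⟩

end DeepPoints

section Flip

variable {F : Type*} [Field F]

/-- The closed loop disjoint from the arc `x₁`, in a triangulation `x₁, x₂, x₃` of the
once-punctured torus with coefficients `u₁, u₂, u₃`. -/
def loopElt (x₁ x₂ x₃ u₂ u₃ : F) : F :=
  (x₂ ^ 2 + u₃ * x₁ ^ 2 + u₂ * u₃ * x₃ ^ 2) / (x₂ * x₃)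

/-- The notched version of the arc `x₁`, in a triangulation `x₁, x₂, x₃` of the once-punctured torus
with coefficients `u₁, u₂, u₃`. -/
def notchedElt (x₁ x₂ x₃ u₁ u₂ u₃ : F) : F :=
  (u₁ * loopElt x₁ x₂ x₃ u₂ u₃ ^ 2 + (1 - u₁ * u₂ * u₃) ^ 2) / x₁

theorem map_notchedElt {F' : Type*} [Field F'] (f : F →+* F') (x₁ x₂ x₃ u₁ u₂ u₃ : F) :
    f (notchedElt x₁ x₂ x₃ u₁ u₂ u₃) =
      notchedElt (f x₁) (f x₂) (f x₃) (f u₁) (f u₂) (f u₃) := by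
  simp only [notchedElt, loopElt, map_div₀, map_add, map_sub, map_mul, map_pow, map_one]

variable {x₁ x₂ x₃ y u₁ u₂ u₃ c : F}

theorem flip_eq (h₁ : x₁ ≠ 0) (h₃ : x₃ ≠ 0) (hy : x₁ * y = c * (u₁ * x₂ ^ 2 + x₃ ^ 2)) :
    y = c * (loopElt x₂ x₃ x₁ u₃ u₁ * x₃ - u₃ * u₁ * x₁) := by
  refine mul_left_cancel₀ h₁ (hy.trans ?_)
  simp only [loopElt]
  field_simp
  ring

theorem loopElt_flip₁ (h₁ : x₁ ≠ 0) (h₂ : x₂ ≠ 0) (h₃ : x₃ ≠ 0) (hc : c ≠ 0)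
    (hy : x₁ * y = c * (u₁ * x₂ ^ 2 + x₃ ^ 2)) :
    loopElt y x₃ x₂ (u₃ * (u₁ * c) ^ 2) (u₂ * (c ^ 2)⁻¹) =
      loopElt x₂ x₃ x₁ u₃ u₁ * loopElt x₃ x₁ x₂ u₁ u₂ - u₁ * loopElt x₁ x₂ x₃ u₂ u₃ := by
  obtain rfl : y = c * (u₁ * x₂ ^ 2 + x₃ ^ 2) / x₁ := (eq_div_iff h₁).2 (by rw [mul_comm, hy])
  simp only [loopElt]
  field_simp
  ring

theorem loopElt_flip₂ (h₁ : x₁ ≠ 0) (h₃ : x₃ ≠ 0) (hy₀ : y ≠ 0)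
    (hy : x₁ * y = c * (u₁ * x₂ ^ 2 + x₃ ^ 2)) :
    loopElt x₂ y x₃ u₁⁻¹ (u₃ * (u₁ * c) ^ 2) = c * loopElt x₂ x₃ x₁ u₃ u₁ := by
  simp only [loopElt]
  field_simp
  linear_combination (y - c * u₁ * u₃ * x₁) * hy

theorem loopElt_flip₃ (h₁ : x₁ ≠ 0) (h₂ : x₂ ≠ 0) (hy₀ : y ≠ 0) (hu₁ : u₁ ≠ 0) (hc : c ≠ 0)
    (hy : x₁ * y = c * (u₁ * x₂ ^ 2 + x₃ ^ 2)) :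
    loopElt x₃ x₂ y (u₂ * (c ^ 2)⁻¹) u₁⁻¹ = (u₁ * c)⁻¹ * loopElt x₃ x₁ x₂ u₁ u₂ := by
  simp only [loopElt]
  field_simp
  linear_combination (u₂ * y - c * x₁) * hy

theorem notchedElt_flip₁ (h₁ : x₁ ≠ 0) (h₂ : x₂ ≠ 0) (h₃ : x₃ ≠ 0) (hy₀ : y ≠ 0) (hu₁ : u₁ ≠ 0)
    (hu₃ : u₃ ≠ 0) (hc : c ≠ 0) (hy : x₁ * y = c * (u₁ * x₂ ^ 2 + x₃ ^ 2)) :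
    notchedElt y x₃ x₂ u₁⁻¹ (u₃ * (u₁ * c) ^ 2) (u₂ * (c ^ 2)⁻¹) =
      (u₁ * u₃ * c)⁻¹ * (loopElt x₂ x₃ x₁ u₃ u₁ * notchedElt x₃ x₁ x₂ u₃ u₁ u₂ -
        notchedElt x₁ x₂ x₃ u₁ u₂ u₃) := by
  rw [notchedElt, loopElt_flip₁ h₁ h₂ h₃ hc hy]
  obtain rfl : y = c * (u₁ * x₂ ^ 2 + x₃ ^ 2) / x₁ := (eq_div_iff h₁).2 (by rw [mul_comm, hy])
  have hbinomial : u₁ * x₂ ^ 2 + x₃ ^ 2 ≠ 0 := right_ne_zero_of_mul (div_ne_zero_iff.1 hy₀).1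
  simp only [notchedElt, loopElt]
  field_simp
  ring

theorem notchedElt_flip₂ (h₁ : x₁ ≠ 0) (h₃ : x₃ ≠ 0) (hy₀ : y ≠ 0) (hc : c ≠ 0)
    (hy : x₁ * y = c * (u₁ * x₂ ^ 2 + x₃ ^ 2)) :
    notchedElt x₂ y x₃ (u₂ * (c ^ 2)⁻¹) u₁⁻¹ (u₃ * (u₁ * c) ^ 2) =
      notchedElt x₂ x₃ x₁ u₂ u₃ u₁ := by
  rw [notchedElt, loopElt_flip₂ h₁ h₃ hy₀ hy, notchedElt]
  field_simp

theorem notchedElt_flip₃ (h₁ : x₁ ≠ 0) (h₂ : x₂ ≠ 0) (hy₀ : y ≠ 0) (hu₁ : u₁ ≠ 0) (hc : c ≠ 0)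
    (hy : x₁ * y = c * (u₁ * x₂ ^ 2 + x₃ ^ 2)) :
    notchedElt x₃ x₂ y (u₃ * (u₁ * c) ^ 2) (u₂ * (c ^ 2)⁻¹) u₁⁻¹ =
      notchedElt x₃ x₁ x₂ u₃ u₁ u₂ := by
  rw [notchedElt, loopElt_flip₃ h₁ h₂ hy₀ hu₁ hc hy, notchedElt]
  field_simp

end Flip

section LaurentMonomial

variable {ι F : Type*} [Fintype ι] [Field F]

/-- The Laurent monomial `∏ yᵢ ^ bᵢ`. -/
def laurentMonomial (y : ι → F) (b : ι → ℤ) : F :=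
  ∏ i, y i ^ b i

theorem laurentMonomial_ne_zero {y : ι → F} (hy : ∀ i, y i ≠ 0) (b : ι → ℤ) :
    laurentMonomial y b ≠ 0 :=
  Finset.prod_ne_zero_iff.2 fun i _ => zpow_ne_zero _ (hy i)

theorem laurentMonomial_neg (y : ι → F) (b : ι → ℤ) :
    laurentMonomial y (-b) = (laurentMonomial y b)⁻¹ := by
  simp only [laurentMonomial, Pi.neg_apply, zpow_neg, Finset.prod_inv_distrib]

theorem laurentMonomial_mul_pow {y : ι → F} (hy : ∀ i, y i ≠ 0) (b c : ι → ℤ) (e : ℤ) :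
    laurentMonomial y b * laurentMonomial y c ^ e = laurentMonomial y (b + e • c) := by
  simp only [laurentMonomial, ← Finset.prod_zpow, ← Finset.prod_mul_distrib]
  refine Finset.prod_congr rfl fun i _ => ?_
  rw [← zpow_mul, ← zpow_add₀ (hy i), Pi.add_apply, Pi.smul_apply, smul_eq_mul, mul_comm e]

theorem posMonomial_eq_laurentMonomial (y : ι → F) (b : ι → ℤ) :
    posMonomial y b = laurentMonomial y fun i => max (b i) 0 := by
  simp only [posMonomial, laurentMonomial, ← Int.toNat_eq_max, zpow_natCast]

theorem laurentMonomial_mem [Algebra ℂ F] {S : Subalgebra ℂ F} {y : ι → F} (hy : ∀ i, y i ∈ S)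
    (hy' : ∀ i, (y i)⁻¹ ∈ S) (b : ι → ℤ) : laurentMonomial y b ∈ S := by
  refine prod_mem fun i _ => ?_
  obtain ⟨d, hd | hd⟩ := (b i).eq_nat_or_neg
  · rw [hd, zpow_natCast]
    exact pow_mem (hy i) d
  · rw [hd, zpow_neg, zpow_natCast, ← inv_pow]
    exact pow_mem (hy' i) d

end LaurentMonomial

section SkeinAlgebra

variable {m : ℕ}

/-- The coefficient `∏ yⱼ ^ bⱼₖ` of the seed in the direction `k`, over the frozen variables
`yⱼ`. -/
noncomputable def Seed.coeff (t : Seed 3 m) (k : Fin 3) : RatFun 3 m :=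
  laurentMonomial (fun a => t.var (Sum.inr a)) fun a => t.mat (Sum.inr a) k

/-- The denominator `∏ yⱼ ^ [-bⱼₖ]₊` of the coefficient in the direction `k`. -/
noncomputable def Seed.coeffDenom (t : Seed 3 m) (k : Fin 3) : RatFun 3 m :=
  posMonomial (fun a => t.var (Sum.inr a)) fun a => -t.mat (Sum.inr a) k

/-- The closed loop disjoint from the `k`-th arc, for a seed of orientation `s`. -/
noncomputable def Seed.loop (t : Seed 3 m) (s k : Fin 3) : RatFun 3 m :=
  loopElt (t.var (Sum.inl k)) (t.var (Sum.inl (k + s))) (t.var (Sum.inl (k - s)))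
    (t.coeff (k + s)) (t.coeff (k - s))

/-- The notched version of the `k`-th arc, for a seed of orientation `s`. -/
noncomputable def Seed.notched (t : Seed 3 m) (s k : Fin 3) : RatFun 3 m :=
  notchedElt (t.var (Sum.inl k)) (t.var (Sum.inl (k + s))) (t.var (Sum.inl (k - s)))
    (t.coeff k) (t.coeff (k + s)) (t.coeff (k - s))

/-- The algebra generated by the frozen variables and their inverses and by the arcs, the closed
loops and the notched arcs of a seed of orientation `s`. It is a mutation-invariant algebra between
the cluster algebra and the upper cluster algebra. -/
noncomputable def Seed.skeinAlgebra (t : Seed 3 m) (s : Fin 3) : Subalgebra ℂ (RatFun 3 m) :=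
  Algebra.adjoin ℂ ((⋃ a, {t.var (Sum.inr a), (t.var (Sum.inr a))⁻¹}) ∪
    ⋃ k, {t.var (Sum.inl k), t.loop s k, t.notched s k})

variable {B : Matrix (Fin 3 ⊕ Fin m) (Fin 3) ℤ} {t : Seed 3 m} {s s₀ : Fin 3}

theorem Seed.skeinAlgebra_le_iff {S : Subalgebra ℂ (RatFun 3 m)} : t.skeinAlgebra s ≤ S ↔
    (∀ a, t.var (Sum.inr a) ∈ S ∧ (t.var (Sum.inr a))⁻¹ ∈ S) ∧
      ∀ k, t.var (Sum.inl k) ∈ S ∧ t.loop s k ∈ S ∧ t.notched s k ∈ S := by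
  simp only [skeinAlgebra, Algebra.adjoin_le_iff, Set.union_subset_iff, Set.iUnion_subset_iff,
    Set.insert_subset_iff, Set.singleton_subset_iff, SetLike.mem_coe]

theorem Seed.coeff_mem {S : Subalgebra ℂ (RatFun 3 m)}
    (hS : ∀ a, t.var (Sum.inr a) ∈ S ∧ (t.var (Sum.inr a))⁻¹ ∈ S) (k : Fin 3) : t.coeff k ∈ S :=
  laurentMonomial_mem (fun a => (hS a).1) (fun a => (hS a).2) _

theorem Seed.coeff_inv_mem {S : Subalgebra ℂ (RatFun 3 m)}
    (hS : ∀ a, t.var (Sum.inr a) ∈ S ∧ (t.var (Sum.inr a))⁻¹ ∈ S) (k : Fin 3) :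
    (t.coeff k)⁻¹ ∈ S := by
  rw [coeff, ← laurentMonomial_neg]
  exact laurentMonomial_mem (fun a => (hS a).1) (fun a => (hS a).2) _

theorem Seed.coeffDenom_mem {S : Subalgebra ℂ (RatFun 3 m)}
    (hS : ∀ a, t.var (Sum.inr a) ∈ S ∧ (t.var (Sum.inr a))⁻¹ ∈ S) (k : Fin 3) :
    t.coeffDenom k ∈ S := by
  rw [coeffDenom, posMonomial_eq_laurentMonomial]
  exact laurentMonomial_mem (fun a => (hS a).1) (fun a => (hS a).2) _

theorem Seed.coeffDenom_inv_mem {S : Subalgebra ℂ (RatFun 3 m)}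
    (hS : ∀ a, t.var (Sum.inr a) ∈ S ∧ (t.var (Sum.inr a))⁻¹ ∈ S) (k : Fin 3) :
    (t.coeffDenom k)⁻¹ ∈ S := by
  rw [coeffDenom, posMonomial_eq_laurentMonomial, ← laurentMonomial_neg]
  exact laurentMonomial_mem (fun a => (hS a).1) (fun a => (hS a).2) _

theorem IsSeed.coeff_ne_zero (ht : IsSeed B t) (k : Fin 3) : t.coeff k ≠ 0 :=
  laurentMonomial_ne_zero ht.frozen_ne_zero _

theorem IsSeed.coeffDenom_ne_zero (ht : IsSeed B t) (k : Fin 3) : t.coeffDenom k ≠ 0 :=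
  posMonomial_ne_zero ht.frozen_ne_zero _

theorem Seed.frozen_mutate (t : Seed 3 m) (k : Fin 3) :
    (fun a => (t.mutate k).var (Sum.inr a)) = fun a => t.var (Sum.inr a) :=
  funext fun _ => t.mutate_var_of_ne k Sum.inr_ne_inl

theorem Seed.coeff_mutate_self (t : Seed 3 m) (k : Fin 3) :
    (t.mutate k).coeff k = (t.coeff k)⁻¹ := by
  rw [coeff, t.frozen_mutate, coeff, ← laurentMonomial_neg]
  congr 1
  funext a
  simp [mutate, mutateMatrix]

theorem IsSeed.coeff_mutate_add (ht : IsSeed B t) (h : Oriented t.mat s) (k : Fin 3) :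
    (t.mutate k).coeff (k + s) = t.coeff (k + s) * (t.coeffDenom k ^ 2)⁻¹ := by
  have hks : k + s ≠ k := by simpa using h.1
  have hpivot : t.mat (Sum.inl k) (k + s) = -2 := by simpa using (h.2 (k + s)).2.2
  rw [Seed.coeff, t.frozen_mutate, Seed.coeff, Seed.coeffDenom, posMonomial_eq_laurentMonomial,
    ← zpow_natCast, ← zpow_neg, laurentMonomial_mul_pow ht.frozen_ne_zero]
  congr 1
  funext a
  simp only [Seed.mutate, mutateMatrix, reduceCtorEq, hks, hpivot, or_self, if_false, Pi.add_apply,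
    Pi.smul_apply, smul_eq_mul]
  norm_num
  ring

theorem IsSeed.coeff_mutate_sub (ht : IsSeed B t) (h : Oriented t.mat s) (k : Fin 3) :
    (t.mutate k).coeff (k - s) = t.coeff (k - s) * (t.coeff k * t.coeffDenom k) ^ 2 := by
  have hks : k - s ≠ k := by simpa using h.1
  have hpivot : t.mat (Sum.inl k) (k - s) = 2 := by simpa using (h.2 (k - s)).2.1
  have hmul := laurentMonomial_mul_pow ht.frozen_ne_zero
  rw [Seed.coeff, t.frozen_mutate, Seed.coeff, Seed.coeff, Seed.coeffDenom,
    posMonomial_eq_laurentMonomial, ← zpow_one (laurentMonomial _ fun a => max _ _), hmul,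
    ← zpow_natCast, hmul]
  congr 1
  funext a
  simp only [Seed.mutate, mutateMatrix, reduceCtorEq, hks, hpivot, or_self, if_false, Pi.add_apply,
    Pi.smul_apply, smul_eq_mul]
  rcases le_total (t.mat (Sum.inr a) k) 0 with ha | ha
  · simp [ha]
  · simp [ha, mul_comm]

theorem IsSeed.var_mul_mutate_var_eq (ht : IsSeed B t) (hB : Oriented B s₀) (h : Oriented t.mat s)
    (k : Fin 3) : t.var (Sum.inl k) * (t.mutate k).var (Sum.inl k) = t.coeffDenom k *
      (t.coeff k * t.var (Sum.inl (k + s)) ^ 2 + t.var (Sum.inl (k - s)) ^ 2) := by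
  have hpos : posMonomial (fun a => t.var (Sum.inr a)) (fun a => t.mat (Sum.inr a) k) =
      t.coeffDenom k * t.coeff k := by
    rw [mul_comm, Seed.coeff, Seed.coeffDenom, posMonomial_eq_laurentMonomial,
      posMonomial_eq_laurentMonomial, ← zpow_one (laurentMonomial _ fun a => max (-_) _),
      laurentMonomial_mul_pow ht.frozen_ne_zero]
    congr 1
    funext a
    rcases le_total (t.mat (Sum.inr a) k) 0 with ha | ha <;> simp [ha]
  rw [ht.var_mul_mutate_var hB.hasSkewPrincipalPart, h.aeval_exchangeBinomial, hpos, mul_add,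
    mul_assoc]
  rfl

theorem Oriented.add_ne (h : Oriented t.mat s) (k : Fin 3) :
    (Sum.inl (k + s) : Fin 3 ⊕ Fin m) ≠ Sum.inl k :=
  Sum.inl_injective.ne (by simpa using h.1)

theorem Oriented.sub_ne (h : Oriented t.mat s) (k : Fin 3) :
    (Sum.inl (k - s) : Fin 3 ⊕ Fin m) ≠ Sum.inl k :=
  Sum.inl_injective.ne (by simpa using h.1)

theorem IsSeed.loop_mutate_self (ht : IsSeed B t) (hB : Oriented B s₀) (h : Oriented t.mat s)
    (k : Fin 3) : (t.mutate k).loop (-s) k =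
      t.loop s (k + s) * t.loop s (k - s) - t.coeff k * t.loop s k := by
  have hx := ht.var_ne_zero hB.hasSkewPrincipalPart
  simp only [Seed.loop, ← sub_eq_add_neg, sub_neg_eq_add, add_sub_cancel_right, sub_add_cancel,
    fin_three_add_add, fin_three_sub_sub, ht.coeff_mutate_add h, ht.coeff_mutate_sub h,
    t.mutate_var_of_ne k (h.add_ne k), t.mutate_var_of_ne k (h.sub_ne k)]
  exact loopElt_flip₁ (hx _) (hx _) (hx _) (ht.coeffDenom_ne_zero k)
    (ht.var_mul_mutate_var_eq hB h k)

theorem IsSeed.loop_mutate_add (ht : IsSeed B t) (hB : Oriented B s₀) (h : Oriented t.mat s)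
    (k : Fin 3) : (t.mutate k).loop (-s) (k + s) = t.coeffDenom k * t.loop s (k + s) := by
  have hx := ht.var_ne_zero hB.hasSkewPrincipalPart
  simp only [Seed.loop, ← sub_eq_add_neg, sub_neg_eq_add, add_sub_cancel_right,
    fin_three_add_add, t.coeff_mutate_self, ht.coeff_mutate_sub h,
    t.mutate_var_of_ne k (h.add_ne k), t.mutate_var_of_ne k (h.sub_ne k)]
  exact loopElt_flip₂ (hx _) (hx _) ((ht.mutate t k).var_ne_zero hB.hasSkewPrincipalPart _)
    (ht.var_mul_mutate_var_eq hB h k)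

theorem IsSeed.loop_mutate_sub (ht : IsSeed B t) (hB : Oriented B s₀) (h : Oriented t.mat s)
    (k : Fin 3) :
    (t.mutate k).loop (-s) (k - s) = (t.coeff k * t.coeffDenom k)⁻¹ * t.loop s (k - s) := by
  have hx := ht.var_ne_zero hB.hasSkewPrincipalPart
  simp only [Seed.loop, ← sub_eq_add_neg, sub_neg_eq_add, sub_add_cancel,
    fin_three_sub_sub, t.coeff_mutate_self, ht.coeff_mutate_add h,
    t.mutate_var_of_ne k (h.add_ne k), t.mutate_var_of_ne k (h.sub_ne k)]
  exact loopElt_flip₃ (hx _) (hx _) ((ht.mutate t k).var_ne_zero hB.hasSkewPrincipalPart _)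
    (ht.coeff_ne_zero k) (ht.coeffDenom_ne_zero k) (ht.var_mul_mutate_var_eq hB h k)

theorem IsSeed.notched_mutate_self (ht : IsSeed B t) (hB : Oriented B s₀) (h : Oriented t.mat s)
    (k : Fin 3) : (t.mutate k).notched (-s) k =
      (t.coeff k * t.coeff (k - s) * t.coeffDenom k)⁻¹ *
        (t.loop s (k + s) * t.notched s (k - s) - t.notched s k) := by
  have hx := ht.var_ne_zero hB.hasSkewPrincipalPart
  simp only [Seed.loop, Seed.notched, ← sub_eq_add_neg, sub_neg_eq_add, add_sub_cancel_right,
    sub_add_cancel, fin_three_add_add, fin_three_sub_sub, t.coeff_mutate_self,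
    ht.coeff_mutate_add h, ht.coeff_mutate_sub h, t.mutate_var_of_ne k (h.add_ne k),
    t.mutate_var_of_ne k (h.sub_ne k)]
  exact notchedElt_flip₁ (hx _) (hx _) (hx _)
    ((ht.mutate t k).var_ne_zero hB.hasSkewPrincipalPart _) (ht.coeff_ne_zero _)
    (ht.coeff_ne_zero _) (ht.coeffDenom_ne_zero k) (ht.var_mul_mutate_var_eq hB h k)

theorem IsSeed.notched_mutate_add (ht : IsSeed B t) (hB : Oriented B s₀) (h : Oriented t.mat s)
    (k : Fin 3) : (t.mutate k).notched (-s) (k + s) = t.notched s (k + s) := by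
  have hx := ht.var_ne_zero hB.hasSkewPrincipalPart
  simp only [Seed.notched, ← sub_eq_add_neg, sub_neg_eq_add, add_sub_cancel_right,
    fin_three_add_add, t.coeff_mutate_self, ht.coeff_mutate_add h, ht.coeff_mutate_sub h,
    t.mutate_var_of_ne k (h.add_ne k), t.mutate_var_of_ne k (h.sub_ne k)]
  exact notchedElt_flip₂ (hx _) (hx _) ((ht.mutate t k).var_ne_zero hB.hasSkewPrincipalPart _)
    (ht.coeffDenom_ne_zero k) (ht.var_mul_mutate_var_eq hB h k)

theorem IsSeed.notched_mutate_sub (ht : IsSeed B t) (hB : Oriented B s₀) (h : Oriented t.mat s)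
    (k : Fin 3) : (t.mutate k).notched (-s) (k - s) = t.notched s (k - s) := by
  have hx := ht.var_ne_zero hB.hasSkewPrincipalPart
  simp only [Seed.notched, ← sub_eq_add_neg, sub_neg_eq_add, sub_add_cancel,
    fin_three_sub_sub, t.coeff_mutate_self, ht.coeff_mutate_add h, ht.coeff_mutate_sub h,
    t.mutate_var_of_ne k (h.add_ne k), t.mutate_var_of_ne k (h.sub_ne k)]
  exact notchedElt_flip₃ (hx _) (hx _) ((ht.mutate t k).var_ne_zero hB.hasSkewPrincipalPart _)
    (ht.coeff_ne_zero k) (ht.coeffDenom_ne_zero k) (ht.var_mul_mutate_var_eq hB h k)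

theorem IsSeed.skeinAlgebra_mutate_le (ht : IsSeed B t) (hB : Oriented B s₀)
    (h : Oriented t.mat s) (k : Fin 3) :
    (t.mutate k).skeinAlgebra (-s) ≤ t.skeinAlgebra s := by
  obtain ⟨hfrozen, hmem⟩ := Seed.skeinAlgebra_le_iff.1 (le_refl (t.skeinAlgebra s))
  have hcoeff := t.coeff_mem hfrozen
  refine Seed.skeinAlgebra_le_iff.2 ⟨fun a => ?_, fun j => ?_⟩
  · simpa only [t.mutate_var_of_ne k Sum.inr_ne_inl] using hfrozen a
  · have hx := ht.var_ne_zero hB.hasSkewPrincipalPart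
    rcases eq_or_eq_add_or_eq_sub j k h.1 with rfl | rfl | rfl
    · have hflip : (t.mutate j).var (Sum.inl j) = t.coeffDenom j *
          (t.loop s (j + s) * t.var (Sum.inl (j - s)) -
            t.coeff (j - s) * t.coeff j * t.var (Sum.inl j)) := by
        rw [Seed.loop, fin_three_add_add, add_sub_cancel_right]
        exact flip_eq (hx _) (hx _) (ht.var_mul_mutate_var_eq hB h j)
      rw [hflip, ht.loop_mutate_self hB h, ht.notched_mutate_self hB h, mul_inv, mul_inv]
      exact ⟨mul_mem (t.coeffDenom_mem hfrozen j) (sub_mem (mul_mem (hmem _).2.1 (hmem _).1)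
          (mul_mem (mul_mem (hcoeff _) (hcoeff _)) (hmem _).1)),
        sub_mem (mul_mem (hmem _).2.1 (hmem _).2.1) (mul_mem (hcoeff _) (hmem _).2.1),
        mul_mem (mul_mem (mul_mem (t.coeff_inv_mem hfrozen _) (t.coeff_inv_mem hfrozen _))
          (t.coeffDenom_inv_mem hfrozen j))
          (sub_mem (mul_mem (hmem _).2.1 (hmem _).2.2) (hmem _).2.2)⟩
    · rw [t.mutate_var_of_ne k (h.add_ne k), ht.loop_mutate_add hB h, ht.notched_mutate_add hB h]
      exact ⟨(hmem _).1, mul_mem (t.coeffDenom_mem hfrozen k) (hmem _).2.1, (hmem _).2.2⟩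
    · rw [t.mutate_var_of_ne k (h.sub_ne k), ht.loop_mutate_sub hB h, ht.notched_mutate_sub hB h,
        mul_inv]
      exact ⟨(hmem _).1, mul_mem (mul_mem (t.coeff_inv_mem hfrozen k)
        (t.coeffDenom_inv_mem hfrozen k)) (hmem _).2.1, (hmem _).2.2⟩

theorem IsSeed.skeinAlgebra_mutate (ht : IsSeed B t) (hB : Oriented B s₀) (h : Oriented t.mat s)
    (k : Fin 3) : (t.mutate k).skeinAlgebra (-s) = t.skeinAlgebra s := by
  refine le_antisymm (ht.skeinAlgebra_mutate_le hB h k) ?_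
  have hle := (ht.mutate t k).skeinAlgebra_mutate_le hB (h.mutate k) k
  rwa [ht.mutate_mutate hB.hasSkewPrincipalPart, neg_neg] at hle

theorem IsSeed.exists_skeinAlgebra_eq (ht : IsSeed B t) (hB : Oriented B s) :
    ∃ s', Oriented t.mat s' ∧ t.skeinAlgebra s' = (initialSeed B).skeinAlgebra s := by
  induction ht with
  | initial => exact ⟨s, hB, rfl⟩
  | mutate t k ht ih =>
    obtain ⟨s', h, heq⟩ := ih
    exact ⟨-s', h.mutate k, (ht.skeinAlgebra_mutate hB h k).trans heq⟩

theorem Seed.skeinAlgebra_le_laurentRing (t : Seed 3 m) (s : Fin 3) :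
    t.skeinAlgebra s ≤ laurentRing t := by
  have hfrozen : ∀ a, t.var (Sum.inr a) ∈ laurentRing t ∧ (t.var (Sum.inr a))⁻¹ ∈ laurentRing t :=
    fun a => ⟨var_mem_laurentRing t _, var_inv_mem_laurentRing t _⟩
  have hcoeff := t.coeff_mem hfrozen
  have hvar := fun i => var_mem_laurentRing t (Sum.inl i)
  have hinv := fun i => var_inv_mem_laurentRing t (Sum.inl i)
  have hloop : ∀ k, t.loop s k ∈ laurentRing t := fun k => by
    rw [loop, loopElt, div_eq_mul_inv, mul_inv]
    exact mul_mem (add_mem (add_mem (pow_mem (hvar _) 2) (mul_mem (hcoeff _) (pow_mem (hvar _) 2)))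
      (mul_mem (mul_mem (hcoeff _) (hcoeff _)) (pow_mem (hvar _) 2))) (mul_mem (hinv _) (hinv _))
  refine skeinAlgebra_le_iff.2 ⟨hfrozen, fun k => ⟨hvar k, hloop k, ?_⟩⟩
  rw [notched, notchedElt, div_eq_mul_inv]
  exact mul_mem (add_mem (mul_mem (hcoeff _) (pow_mem (hloop k) 2)) (pow_mem (sub_mem (one_mem _)
    (mul_mem (mul_mem (hcoeff _) (hcoeff _)) (hcoeff _))) 2)) (hinv _)

theorem Oriented.skeinAlgebra_le_upperClusterAlgebra (hB : Oriented B s) :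
    (initialSeed B).skeinAlgebra s ≤ upperClusterAlgebra B :=
  le_iInf₂ fun t ht => by
    obtain ⟨s', -, heq⟩ := ht.exists_skeinAlgebra_eq hB
    exact heq ▸ t.skeinAlgebra_le_laurentRing s'

theorem Oriented.clusterAlgebra_le_skeinAlgebra (hB : Oriented B s) :
    clusterAlgebra B ≤ (initialSeed B).skeinAlgebra s := by
  have hinit := Seed.skeinAlgebra_le_iff.1 (le_refl ((initialSeed B).skeinAlgebra s))
  refine Algebra.adjoin_le ?_
  rintro z ((⟨t, ht, i, rfl⟩ | ⟨a, rfl⟩) | ⟨a, ha⟩)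
  · obtain ⟨s', -, heq⟩ := ht.exists_skeinAlgebra_eq hB
    exact heq ▸ ((Seed.skeinAlgebra_le_iff.1 le_rfl).2 i).1
  · exact (hinit.1 a).1
  · rw [← inv_inv z, ← ha]
    exact (hinit.1 a).2

theorem Oriented.clusterAlgebra_le_upperClusterAlgebra (hB : Oriented B s) :
    clusterAlgebra B ≤ upperClusterAlgebra B :=
  hB.clusterAlgebra_le_skeinAlgebra.trans hB.skeinAlgebra_le_upperClusterAlgebra

end SkeinAlgebra

end ClusterAlg

namespace ClusterAlg

section Slice

variable {R : Type*} [CommRing R]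

/-- The coefficients along a two-parameter slice of the torus of the initial seed. -/
def sliceCoeff (s t : R) : Fin 3 → R := ![s, 1, t]

/-- The closed loops along the slice. -/
def sliceLoop (s t : R) : Fin 3 → R := ![2 + t, 1 + t + s * t, 1 + 2 * s]

/-- The arcs along the slice; they are chosen so that each notched arc is constant with
value `1`. -/
def sliceArc (s t : R) (k : Fin 3) : R :=
  sliceCoeff s t k * sliceLoop s t k ^ 2 + (1 - s * t) ^ 2

/-- The flips of the arcs along the slice. -/
def sliceFlip (s t : R) (k : Fin 3) : R :=
  sliceLoop s t (k + 1) * sliceArc s t (k - 1) -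
    sliceCoeff s t (k - 1) * sliceCoeff s t k * sliceArc s t k

theorem sliceArc_mul_sliceFlip (s t : R) (k : Fin 3) :
    sliceArc s t k * sliceFlip s t k =
      sliceCoeff s t k * sliceArc s t (k + 1) ^ 2 + sliceArc s t (k - 1) ^ 2 := by
  fin_cases k <;> simp [sliceArc, sliceFlip, sliceLoop, sliceCoeff] <;> ring

theorem sliceLoop_mul (s t : R) (k : Fin 3) :
    sliceLoop s t k * (sliceArc s t (k + 1) * sliceArc s t (k - 1)) =
      sliceArc s t (k + 1) ^ 2 + sliceCoeff s t (k - 1) * sliceArc s t k ^ 2 +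
        sliceCoeff s t (k + 1) * sliceCoeff s t (k - 1) * sliceArc s t (k - 1) ^ 2 := by
  fin_cases k <;> simp [sliceArc, sliceLoop, sliceCoeff] <;> ring

variable {R' : Type*} [CommRing R'] (f : R →+* R') (s t : R)

theorem map_sliceCoeff (k : Fin 3) : f (sliceCoeff s t k) = sliceCoeff (f s) (f t) k := by
  fin_cases k <;> simp [sliceCoeff]

theorem map_sliceLoop (k : Fin 3) : f (sliceLoop s t k) = sliceLoop (f s) (f t) k := by
  fin_cases k <;> simp [sliceLoop, map_ofNat f 2]

theorem map_sliceArc (k : Fin 3) : f (sliceArc s t k) = sliceArc (f s) (f t) k := by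
  simp only [sliceArc, map_add, map_sub, map_mul, map_pow, map_one, map_sliceCoeff, map_sliceLoop]

theorem map_sliceFlip (k : Fin 3) : f (sliceFlip s t k) = sliceFlip (f s) (f t) k := by
  simp only [sliceFlip, map_sub, map_mul, map_sliceCoeff, map_sliceLoop, map_sliceArc]

end Slice

section GenericSlice

variable {R : Type*} [CommRing R] {s t : R}

/-- Parameters near the base point `(-1/2, -2)` of the slice, but distinct from it: the
inequalities cut out a punctured neighbourhood in which every point lies in the torus of the initial
seed or of one of its three neighbours. -/
structure IsGenericSlice (s t : R) : Prop where
  coeff_ne_zero : ∀ k, sliceCoeff s t k ≠ 0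
  s_add_one_ne_zero : s + 1 ≠ 0
  t_add_one_ne_zero : t + 1 ≠ 0
  four_mul_sq_add_one_ne_zero : 4 * s ^ 2 + 1 ≠ 0
  two_ne_zero : (2 : R) ≠ 0
  not_base : ¬(2 + t = 0 ∧ 1 + 2 * s = 0)

namespace IsGenericSlice

theorem two_add_ne_zero (h : IsGenericSlice s t) (hst : 1 - s * t = 0) : 2 + t ≠ 0 :=
  fun ht => h.not_base ⟨ht, by linear_combination hst + s * ht⟩

variable [IsDomain R]

theorem sliceArc_zero_or_one_ne_zero (h : IsGenericSlice s t) :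
    sliceArc s t 0 ≠ 0 ∨ sliceArc s t 1 ≠ 0 := by
  by_contra! ⟨h₀, h₁⟩
  have e₀ : s * (2 + t) ^ 2 + (1 - s * t) ^ 2 = 0 := h₀
  have e₁ : 1 * (1 + t + s * t) ^ 2 + (1 - s * t) ^ 2 = 0 := h₁
  have hmul : (1 - s * t) * (-2 * s * (2 + t) + (2 * s - 1) * (1 - s * t)) = 0 := by
    linear_combination s * e₁ - e₀
  have hst : 1 - s * t = 0 := by
    refine (mul_eq_zero.1 hmul).elim id fun hfactor => ?_
    have hsq : (4 * s ^ 2 + 1) * (1 - s * t) ^ 2 = 0 := by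
      linear_combination 4 * s * e₀ - (-2 * s * (2 + t) - (2 * s - 1) * (1 - s * t)) * hfactor
    exact pow_eq_zero_iff (NeZero.ne 2) |>.1
      ((mul_eq_zero.1 hsq).resolve_left h.four_mul_sq_add_one_ne_zero)
  have hs : s * (2 + t) ^ 2 = 0 := by linear_combination e₀ - (1 - s * t) * hst
  exact mul_ne_zero (h.coeff_ne_zero 0) (pow_ne_zero 2 (h.two_add_ne_zero hst)) hs

theorem sliceArc_ne_zero_of_ne (h : IsGenericSlice s t) {j k : Fin 3} (hk : sliceArc s t k = 0)
    (hjk : j ≠ k) : sliceArc s t j ≠ 0 := by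
  intro hj
  have hexchange := sliceArc_mul_sliceFlip s t k
  rw [hk, zero_mul] at hexchange
  have hall : ∀ i, sliceArc s t i = 0 := by
    have hiff : sliceArc s t (k + 1) = 0 ↔ sliceArc s t (k - 1) = 0 := by
      constructor <;> intro h' <;> simpa [h', h.coeff_ne_zero k] using hexchange.symm
    have hadd : sliceArc s t (k + 1) = 0 := by
      rcases eq_or_eq_add_or_eq_sub j k one_ne_zero with rfl | rfl | rfl
      exacts [(hjk rfl).elim, hj, hiff.2 hj]
    intro i
    rcases eq_or_eq_add_or_eq_sub i k one_ne_zero with rfl | rfl | rfl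
    exacts [hk, hadd, hiff.1 hadd]
  exact h.sliceArc_zero_or_one_ne_zero.elim (fun h₀ => h₀ (hall 0)) fun h₁ => h₁ (hall 1)

theorem sliceFlip_ne_zero (h : IsGenericSlice s t) {k : Fin 3} (hk : sliceArc s t k = 0) :
    sliceFlip s t k ≠ 0 := by
  intro hflip
  have hloop : sliceLoop s t (k + 1) = 0 := by
    rw [sliceFlip, hk, mul_zero, sub_zero] at hflip
    exact (mul_eq_zero.1 hflip).resolve_right
      (h.sliceArc_ne_zero_of_ne hk (by simp))
  have hst : ∀ c : R, c ≠ 0 → c * (1 - s * t) ^ 2 = 0 → 1 - s * t = 0 := fun c hc hmul =>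
    pow_eq_zero_iff (NeZero.ne 2) |>.1 ((mul_eq_zero.1 hmul).resolve_left hc)
  fin_cases k
  · have e₀ : s * (2 + t) ^ 2 + (1 - s * t) ^ 2 = 0 := hk
    have hl : 1 + t + s * t = 0 := hloop
    have hst := hst _ h.s_add_one_ne_zero
      (by linear_combination e₀ - s * (2 + t + (1 - s * t)) * hl)
    exact h.two_add_ne_zero hst (by linear_combination hl + hst)
  · have e₁ : 1 * (1 + t + s * t) ^ 2 + (1 - s * t) ^ 2 = 0 := hk
    have hl : 1 + 2 * s = 0 := hloop
    have hst := hst _ h.two_ne_zero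
      (by linear_combination e₁ - t * (1 + t + s * t + (1 - s * t)) * hl)
    exact h.two_add_ne_zero hst (by linear_combination 2 * hst + t * hl)
  · have e₂ : t * (1 + 2 * s) ^ 2 + (1 - s * t) ^ 2 = 0 := hk
    have hl : 2 + t = 0 := hloop
    have hst := hst _ h.t_add_one_ne_zero
      (by linear_combination e₂ - t * s * (1 + 2 * s + (1 - s * t)) * hl)
    exact h.two_add_ne_zero hst hl

theorem forall_sliceArc_ne_zero_or (h : IsGenericSlice s t) :
    (∀ j, sliceArc s t j ≠ 0) ∨
      ∃ k, sliceFlip s t k ≠ 0 ∧ ∀ j, j ≠ k → sliceArc s t j ≠ 0 := by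
  refine or_iff_not_imp_left.2 fun hall => ?_
  obtain ⟨k, hk⟩ := not_forall_not.1 hall
  exact ⟨k, h.sliceFlip_ne_zero hk, fun j hjk => h.sliceArc_ne_zero_of_ne hk hjk⟩

end IsGenericSlice

end GenericSlice

section BasePoint

open Polynomial

/-- The coordinate ring of the parameter plane of the slice. -/
abbrev SliceRing : Type := Polynomial (Polynomial ℂ)

/-- The first parameter of the slice. -/
noncomputable def paramS : SliceRing := C X

/-- The second parameter of the slice. -/
noncomputable def paramT : SliceRing := X

/-- Evaluation at the base point of the slice, where all three arcs vanish. -/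
noncomputable def sliceBase : SliceRing →ₐ[ℂ] ℂ :=
  aevalAeval (-1 / 2) (-2)

theorem sliceBase_paramS : sliceBase paramS = -1 / 2 :=
  aevalAeval_X _ _

theorem sliceBase_paramT : sliceBase paramT = -2 :=
  aevalAeval_Y _ _

theorem sliceBase_sliceArc (k : Fin 3) : sliceBase (sliceArc paramS paramT k) = 0 := by
  change (sliceBase : SliceRing →+* ℂ) _ = 0
  rw [map_sliceArc, RingHom.coe_coe, sliceBase_paramS, sliceBase_paramT]
  fin_cases k <;> norm_num [sliceArc, sliceCoeff, sliceLoop]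

theorem sliceBase_sliceCoeff_ne_zero (k : Fin 3) : sliceBase (sliceCoeff paramS paramT k) ≠ 0 := by
  change (sliceBase : SliceRing →+* ℂ) _ ≠ 0
  rw [map_sliceCoeff, RingHom.coe_coe, sliceBase_paramS, sliceBase_paramT]
  fin_cases k <;> norm_num [sliceCoeff]

theorem sliceCoeff_ne_zero (k : Fin 3) : sliceCoeff paramS paramT k ≠ 0 :=
  ne_zero_of_map (sliceBase_sliceCoeff_ne_zero k)

theorem sliceArc_ne_zero (k : Fin 3) : sliceArc paramS paramT k ≠ 0 := by
  refine ne_zero_of_map (f := (aevalAeval 1 2 : SliceRing →ₐ[ℂ] ℂ).toRingHom) ?_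
  rw [map_sliceArc]
  change sliceArc (aevalAeval (R := ℂ) 1 2 (C X)) (aevalAeval (R := ℂ) 1 2 X) k ≠ 0
  rw [aevalAeval_X, aevalAeval_Y]
  fin_cases k <;> norm_num [sliceArc, sliceCoeff, sliceLoop]

theorem isGenericSlice_mk {π : SliceRing} (hπ : Prime π) (h₀ : sliceBase π = 0) :
    IsGenericSlice (Ideal.Quotient.mk (Ideal.span {π}) paramS)
      (Ideal.Quotient.mk (Ideal.span {π}) paramT) := by
  set mk := Ideal.Quotient.mk (Ideal.span {π})
  have hne : ∀ a, sliceBase a ≠ 0 → mk a ≠ 0 := fun a ha hmk => by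
    obtain ⟨b, rfl⟩ := Ideal.Quotient.eq_zero_iff_dvd _ _ |>.1 hmk
    exact ha (by rw [map_mul, h₀, zero_mul])
  refine ⟨fun k => ?_, ?_, ?_, ?_, ?_, ?_⟩
  · rw [← map_sliceCoeff]
    exact hne _ (sliceBase_sliceCoeff_ne_zero k)
  · rw [← map_one mk, ← map_add]
    exact hne _ (by rw [map_add, map_one, sliceBase_paramS]; norm_num)
  · rw [← map_one mk, ← map_add]
    exact hne _ (by rw [map_add, map_one, sliceBase_paramT]; norm_num)
  · rw [← map_ofNat mk 4, ← map_one mk, ← map_pow, ← map_mul, ← map_add]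
    exact hne _ (by rw [map_add, map_one, map_mul, map_pow, sliceBase_paramS, map_ofNat]; norm_num)
  · rw [← map_ofNat mk 2]
    exact hne _ (by rw [map_ofNat]; norm_num)
  · rintro ⟨hT, hS⟩
    rw [← map_ofNat mk 2, ← map_add, Ideal.Quotient.eq_zero_iff_dvd] at hT
    rw [← map_ofNat mk 2, ← map_one mk, ← map_mul, ← map_add, Ideal.Quotient.eq_zero_iff_dvd] at hS
    have eT : 2 + paramT = X - C (-2) := by
      rw [paramT, map_neg, sub_neg_eq_add, add_comm, map_ofNat C 2]
    have eS : 1 + 2 * paramS = C (1 + 2 * X) := by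
      rw [paramS, map_add, map_mul, map_one, map_ofNat C 2]
    rw [eT] at hT
    rw [eS, ((hπ.associated_of_dvd (prime_X_sub_C _) hT).dvd_iff_dvd_left), dvd_iff_isRoot,
      IsRoot.def, eval_C] at hS
    simpa using congrArg (Polynomial.eval 0) hS

theorem forall_not_dvd_sliceArc_or {π : SliceRing} (hπ : Prime π) (h₀ : sliceBase π = 0) :
    (∀ j, ¬π ∣ sliceArc paramS paramT j) ∨
      ∃ k, ¬π ∣ sliceFlip paramS paramT k ∧ ∀ j, j ≠ k → ¬π ∣ sliceArc paramS paramT j := by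
  have hprime : (Ideal.span {π}).IsPrime := (Ideal.span_singleton_prime hπ.ne_zero).2 hπ
  simp only [← Ideal.Quotient.eq_zero_iff_dvd, map_sliceArc, map_sliceFlip]
  exact (isGenericSlice_mk hπ h₀).forall_sliceArc_ne_zero_or

end BasePoint

section RegularFractions

variable {P k : Type*} [CommRing P] [Field k]

theorem exists_prime_dvd_of_map_eq_zero [UniqueFactorizationMonoid P] (ev : P →+* k)
    {c : P} (hc : c ≠ 0) (hev : ev c = 0) : ∃ π, Prime π ∧ π ∣ c ∧ ev π = 0 := by
  induction c using UniqueFactorizationMonoid.induction_on_prime with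
  | h₁ => exact absurd rfl hc
  | h₂ x hx => exact absurd hev (hx.map ev).ne_zero
  | h₃ a p ha hp ih =>
    rw [map_mul, mul_eq_zero] at hev
    rcases hev with hev | hev
    · exact ⟨p, hp, dvd_mul_right _ _, hev⟩
    · obtain ⟨π, hπ, hdvd, hevπ⟩ := ih ha hev
      exact ⟨π, hπ, hdvd.mul_left _, hevπ⟩

variable {K : Type*} [IsDomain P] [Field K] [Algebra P K] [IsFractionRing P K]

theorem exists_algHom_of_forall_mul_eq {R : Type*} [CommRing R] [Algebra k P] [Algebra k K]
    [IsScalarTower k P K] [Algebra k R] (ev : P →ₐ[k] k) (Ψ : R →ₐ[k] K)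
    (h : ∀ u, ∃ a b : P, ev b ≠ 0 ∧ Ψ u * algebraMap P K b = algebraMap P K a) :
    ∃ p : R →ₐ[k] k, ∀ u a, Ψ u = algebraMap P K a → p u = ev a := by
  have : (RingHom.ker ev).IsPrime := RingHom.ker_isPrime ev
  have hS : (RingHom.ker ev).primeCompl ≤ nonZeroDivisors P := Ideal.primeCompl_le_nonZeroDivisors _
  let L := Localization.subalgebra.ofField K (RingHom.ker ev).primeCompl hS
  have hΨ : ∀ u, Ψ u ∈ L.restrictScalars k := fun u => by
    obtain ⟨a, b, hb, hab⟩ := h u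
    have hb₀ : algebraMap P K b ≠ 0 := by
      rw [Ne, FaithfulSMul.algebraMap_eq_zero_iff]
      exact ne_zero_of_map hb
    exact ⟨a, b, hb, (eq_mul_inv_iff_mul_eq₀ hb₀).2 hab⟩
  let ev' : L →ₐ[k] k := IsLocalization.liftAlgHom (M := (RingHom.ker ev).primeCompl) (f := ev)
    fun b => (show ev b ≠ 0 from b.2).isUnit
  refine ⟨ev'.comp (Ψ.codRestrict (L.restrictScalars k) hΨ), fun u a hu => ?_⟩
  have hu' : Ψ.codRestrict (L.restrictScalars k) hΨ u = algebraMap P L a := Subtype.ext hu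
  refine (congrArg ev' hu').trans ?_
  exact IsLocalization.lift_eq _ a

variable [UniqueFactorizationMonoid P]

theorem exists_reduced_fraction_not_dvd (f : K) :
    ∃ a b : P, b ≠ 0 ∧ f * algebraMap P K b = algebraMap P K a ∧ ∀ π : P, Prime π →
      (∃ a' b' : P, ¬π ∣ b' ∧ f * algebraMap P K b' = algebraMap P K a') → ¬π ∣ b := by
  obtain ⟨a, b, hab, hf⟩ := IsFractionRing.exists_reduced_fraction (A := P) f
  have hfb : f * algebraMap P K b = algebraMap P K a := by
    rw [← hf]
    exact IsLocalization.mk'_spec K a b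
  refine ⟨a, b, nonZeroDivisors.coe_ne_zero b, hfb, fun π hπ ⟨a', b', hb', hf'⟩ hπb => ?_⟩
  have heq : a * b' = a' * b := by
    apply IsFractionRing.injective P K
    rw [map_mul, map_mul, ← hfb, ← hf']
    ring
  have hπa : π ∣ a :=
    (hπ.dvd_or_dvd (heq ▸ hπb.mul_left a' : π ∣ a * b')).resolve_right hb'
  exact hπ.not_isUnit (hab hπa hπb)

theorem exists_mul_eq_of_forall_prime (ev : P →+* k) (f : K)
    (h : ∀ π : P, Prime π → ev π = 0 →
      ∃ a b : P, ¬π ∣ b ∧ f * algebraMap P K b = algebraMap P K a) :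
    ∃ a b : P, ev b ≠ 0 ∧ f * algebraMap P K b = algebraMap P K a := by
  obtain ⟨a, b, hb₀, hfb, hb⟩ := exists_reduced_fraction_not_dvd (P := P) f
  refine ⟨a, b, fun hev => ?_, hfb⟩
  obtain ⟨π, hπ, hπb, hevπ⟩ := exists_prime_dvd_of_map_eq_zero ev hb₀ hev
  exact hb π hπ (h π hπ hevπ) hπb

end RegularFractions

end ClusterAlg

namespace ClusterAlg

open MvPolynomial

theorem upperClusterAlgebra_le_laurentRing {n m : ℕ} {B : Matrix (Fin n ⊕ Fin m) (Fin n) ℤ}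
    {t : Seed n m} (ht : IsSeed B t) : upperClusterAlgebra B ≤ laurentRing t :=
  iInf₂_le t ht

theorem exists_mul_eq_of_forall_not_dvd {n m : ℕ} {t : Seed n m} (h0 : ∀ i, t.var i ≠ 0)
    {R : Subalgebra ℂ (RatFun n m)} (hR : ∀ i, t.var i ∈ R) {P K : Type*} [CommRing P]
    [Algebra ℂ P] [Field K] [Algebra P K] [Algebra ℂ K] [IsScalarTower ℂ P K] {Ψ : R →ₐ[ℂ] K}
    {v : Fin n ⊕ Fin m → P} (hv : ∀ i, Ψ ⟨t.var i, hR i⟩ = algebraMap P K (v i)) {π : P}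
    (hπ : Prime π) (hπv : ∀ i, ¬π ∣ v i) {u : R} (hu : (u : RatFun n m) ∈ laurentRing t) :
    ∃ a b : P, ¬π ∣ b ∧ Ψ u * algebraMap P K b = algebraMap P K a := by
  obtain ⟨N, g, hg⟩ := exists_mul_prod_pow_eq_aeval h0 hu
  refine ⟨aeval v g, (∏ i, v i) ^ N, fun hdvd => ?_, ?_⟩
  · obtain ⟨i, -, hi⟩ := (Prime.dvd_finsetProd_iff hπ _).1 (hπ.dvd_of_dvd_pow hdvd)
    exact hπv i hi
  · have hmap := map_mul_prod_pow hR u.2 hg Ψ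
    simp only [hv] at hmap
    rw [map_pow, map_prod]
    exact hmap.trans (comp_aeval_apply v (IsScalarTower.toAlgHom ℂ P K) g).symm

theorem IsSeed.coord_eq_zero_of_initial {m : ℕ} {B : Matrix (Fin 3 ⊕ Fin m) (Fin 3) ℤ}
    {t : Seed 3 m} {s : Fin 3} (ht : IsSeed B t) (hB : Oriented B s)
    {p : Points (clusterAlgebra B)}
    (hp : ∀ j, (IsSeed.initial (B := B)).coord p (Sum.inl j) = 0) (j : Fin 3) :
    ht.coord p (Sum.inl j) = 0 := by
  induction ht generalizing j with
  | initial => exact hp j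
  | mutate t k ht ih =>
    have hne {i : Fin 3} (hi : i ≠ k) : (IsSeed.mutate t k ht).coord p (Sum.inl i) = 0 :=
      (ht.coord_mutate_of_ne p (Sum.inl_injective.ne hi)).trans (ih i)
    rcases eq_or_ne j k with rfl | hj
    · obtain ⟨i, hij, -⟩ := exists_ne_and_ne_fin_three j j
      obtain ⟨l, hlj, hli⟩ := exists_ne_and_ne_fin_three j i
      refine ((ht.mutate t j).coord_eq_zero_iff_of_mul_eq_zero hB ?_ hij.symm hli).2 (hne hlj)
      rw [hne hij, zero_mul]
    · exact hne hj

section PrincipalCoefficients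

theorem oriented_markovPrinMatrix : Oriented markovPrinMatrix 1 :=
  oriented_of_toRows₁_eq (Matrix.toRows₁_fromRows _ _)

/-- The initial seed of the Markov cluster algebra with principal coefficients. -/
noncomputable abbrev prinSeed : Seed 3 3 := initialSeed markovPrinMatrix

theorem prinSeed_coeff (k : Fin 3) : prinSeed.coeff k = prinSeed.var (Sum.inr k) := by
  rw [Seed.coeff, laurentMonomial, Finset.prod_eq_single k]
  · simp [initialSeed, markovPrinMatrix]
  · intro j _ hj
    simp [initialSeed, markovPrinMatrix, Matrix.one_apply_ne hj]
  · simp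

theorem prinSeed_coeffDenom (k : Fin 3) : prinSeed.coeffDenom k = 1 := by
  rw [Seed.coeffDenom, posMonomial]
  refine Finset.prod_eq_one fun j _ => ?_
  rcases eq_or_ne j k with rfl | hj
  · simp [initialSeed, markovPrinMatrix]
  · simp [initialSeed, markovPrinMatrix, Matrix.one_apply_ne hj]

theorem prinSeed_var_ne_zero (i : Fin 3 ⊕ Fin 3) : prinSeed.var i ≠ 0 :=
  IsSeed.initial.var_ne_zero oriented_markovPrinMatrix.hasSkewPrincipalPart i

theorem prinSeed_var_mul_mutate_var (k : Fin 3) :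
    prinSeed.var (Sum.inl k) * (prinSeed.mutate k).var (Sum.inl k) =
      prinSeed.var (Sum.inr k) * prinSeed.var (Sum.inl (k + 1)) ^ 2 +
        prinSeed.var (Sum.inl (k - 1)) ^ 2 := by
  rw [IsSeed.initial.var_mul_mutate_var_eq oriented_markovPrinMatrix oriented_markovPrinMatrix,
    prinSeed_coeff, prinSeed_coeffDenom, one_mul]

theorem prinSeed_loop_mul (k : Fin 3) :
    prinSeed.loop 1 k * (prinSeed.var (Sum.inl (k + 1)) * prinSeed.var (Sum.inl (k - 1))) =
      prinSeed.var (Sum.inl (k + 1)) ^ 2 +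
        prinSeed.var (Sum.inr (k - 1)) * prinSeed.var (Sum.inl k) ^ 2 +
        prinSeed.var (Sum.inr (k + 1)) * prinSeed.var (Sum.inr (k - 1)) *
          prinSeed.var (Sum.inl (k - 1)) ^ 2 := by
  rw [Seed.loop, loopElt, prinSeed_coeff, prinSeed_coeff,
    div_mul_cancel₀ _ (mul_ne_zero (prinSeed_var_ne_zero _) (prinSeed_var_ne_zero _))]

theorem prinSeed_var_mul_notched (k : Fin 3) :
    prinSeed.var (Sum.inl k) * prinSeed.notched 1 k =
      prinSeed.var (Sum.inr k) * prinSeed.loop 1 k ^ 2 +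
        (1 - prinSeed.var (Sum.inr k) * prinSeed.var (Sum.inr (k + 1)) *
          prinSeed.var (Sum.inr (k - 1))) ^ 2 := by
  rw [Seed.notched, notchedElt, mul_div_cancel₀ _ (prinSeed_var_ne_zero _), Seed.loop]
  simp only [prinSeed_coeff]

theorem var_mem_upperClusterAlgebra_prin {t : Seed 3 3} (ht : IsSeed markovPrinMatrix t)
    (i : Fin 3 ⊕ Fin 3) : t.var i ∈ upperClusterAlgebra markovPrinMatrix :=
  oriented_markovPrinMatrix.clusterAlgebra_le_upperClusterAlgebra (ht.var_mem_clusterAlgebra i)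

theorem prinSeed_loop_mem (k : Fin 3) :
    prinSeed.loop 1 k ∈ upperClusterAlgebra markovPrinMatrix :=
  ((Seed.skeinAlgebra_le_iff.1
    oriented_markovPrinMatrix.skeinAlgebra_le_upperClusterAlgebra).2 k).2.1

theorem prinSeed_notched_mem (k : Fin 3) :
    prinSeed.notched 1 k ∈ upperClusterAlgebra markovPrinMatrix :=
  ((Seed.skeinAlgebra_le_iff.1
    oriented_markovPrinMatrix.skeinAlgebra_le_upperClusterAlgebra).2 k).2.2

end PrincipalCoefficients

section SliceRestriction

/-- The values of the initial extended cluster along the slice. -/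
noncomputable def sliceVar : Fin 3 ⊕ Fin 3 → SliceRing :=
  Sum.elim (sliceArc paramS paramT) (sliceCoeff paramS paramT)

/-- `Ψ` restricts the elements of the upper cluster algebra to the slice, as rational functions of
the two parameters. -/
def IsSliceRestriction
    (Ψ : upperClusterAlgebra markovPrinMatrix →ₐ[ℂ] FractionRing SliceRing) : Prop :=
  ∀ i, Ψ ⟨prinSeed.var i, var_mem_upperClusterAlgebra_prin .initial i⟩ =
    algebraMap SliceRing _ (sliceVar i)

theorem algebraMap_sliceArc_ne_zero (k : Fin 3) :
    algebraMap SliceRing (FractionRing SliceRing) (sliceArc paramS paramT k) ≠ 0 := by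
  rw [Ne, FaithfulSMul.algebraMap_eq_zero_iff]
  exact sliceArc_ne_zero k

theorem exists_isSliceRestriction : ∃ Ψ, IsSliceRestriction Ψ := by
  obtain ⟨q, hq⟩ := exists_laurentRing_algHom
    (IsSeed.initial.algebraicIndependent oriented_markovPrinMatrix.hasSkewPrincipalPart)
    (c := fun i => algebraMap SliceRing (FractionRing SliceRing) (sliceVar i)) (fun i => by
      rw [Ne, FaithfulSMul.algebraMap_eq_zero_iff]
      exact Sum.rec sliceArc_ne_zero sliceCoeff_ne_zero i)
  exact ⟨q.comp (Subalgebra.inclusion (upperClusterAlgebra_le_laurentRing .initial)),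
    fun i => hq i⟩

namespace IsSliceRestriction

variable {Ψ : upperClusterAlgebra markovPrinMatrix →ₐ[ℂ] FractionRing SliceRing}

theorem apply_var_inl (hΨ : IsSliceRestriction Ψ) (k : Fin 3) :
    Ψ ⟨prinSeed.var (Sum.inl k), var_mem_upperClusterAlgebra_prin .initial _⟩ =
      algebraMap SliceRing _ (sliceArc paramS paramT k) :=
  hΨ (Sum.inl k)

theorem apply_var_inr (hΨ : IsSliceRestriction Ψ) (k : Fin 3) :
    Ψ ⟨prinSeed.var (Sum.inr k), var_mem_upperClusterAlgebra_prin .initial _⟩ =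
      algebraMap SliceRing _ (sliceCoeff paramS paramT k) :=
  hΨ (Sum.inr k)

theorem apply_mutate_var (hΨ : IsSliceRestriction Ψ) (k : Fin 3) :
    Ψ ⟨(prinSeed.mutate k).var (Sum.inl k),
      var_mem_upperClusterAlgebra_prin (.mutate _ k .initial) _⟩ =
      algebraMap SliceRing _ (sliceFlip paramS paramT k) := by
  have hexchange := congrArg Ψ (Subtype.ext (prinSeed_var_mul_mutate_var k) :
    (⟨_, var_mem_upperClusterAlgebra_prin .initial (Sum.inl k)⟩ :
        upperClusterAlgebra markovPrinMatrix) *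
      ⟨_, var_mem_upperClusterAlgebra_prin (.mutate _ k .initial) (Sum.inl k)⟩ =
      ⟨_, var_mem_upperClusterAlgebra_prin .initial (Sum.inr k)⟩ *
        ⟨_, var_mem_upperClusterAlgebra_prin .initial (Sum.inl (k + 1))⟩ ^ 2 +
        ⟨_, var_mem_upperClusterAlgebra_prin .initial (Sum.inl (k - 1))⟩ ^ 2)
  simp only [map_mul, map_add, map_pow, hΨ.apply_var_inl, hΨ.apply_var_inr] at hexchange
  refine mul_left_cancel₀ (algebraMap_sliceArc_ne_zero k) (hexchange.trans ?_)
  rw [← map_mul, sliceArc_mul_sliceFlip]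
  simp only [map_mul, map_add, map_pow]

theorem apply_loop (hΨ : IsSliceRestriction Ψ) (k : Fin 3) :
    Ψ ⟨prinSeed.loop 1 k, prinSeed_loop_mem k⟩ =
      algebraMap SliceRing _ (sliceLoop paramS paramT k) := by
  have hloop := congrArg Ψ (Subtype.ext (prinSeed_loop_mul k) :
    (⟨_, prinSeed_loop_mem k⟩ : upperClusterAlgebra markovPrinMatrix) *
      (⟨_, var_mem_upperClusterAlgebra_prin .initial (Sum.inl (k + 1))⟩ *
        ⟨_, var_mem_upperClusterAlgebra_prin .initial (Sum.inl (k - 1))⟩) =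
      ⟨_, var_mem_upperClusterAlgebra_prin .initial (Sum.inl (k + 1))⟩ ^ 2 +
        ⟨_, var_mem_upperClusterAlgebra_prin .initial (Sum.inr (k - 1))⟩ *
          ⟨_, var_mem_upperClusterAlgebra_prin .initial (Sum.inl k)⟩ ^ 2 +
        ⟨_, var_mem_upperClusterAlgebra_prin .initial (Sum.inr (k + 1))⟩ *
          ⟨_, var_mem_upperClusterAlgebra_prin .initial (Sum.inr (k - 1))⟩ *
          ⟨_, var_mem_upperClusterAlgebra_prin .initial (Sum.inl (k - 1))⟩ ^ 2)
  simp only [map_mul, map_add, map_pow, hΨ.apply_var_inl, hΨ.apply_var_inr] at hloop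
  refine mul_right_cancel₀
    (mul_ne_zero (algebraMap_sliceArc_ne_zero (k + 1)) (algebraMap_sliceArc_ne_zero (k - 1)))
    (hloop.trans ?_)
  have hslice := congrArg (algebraMap SliceRing (FractionRing SliceRing))
    (sliceLoop_mul paramS paramT k)
  simp only [map_mul, map_add, map_pow] at hslice
  exact hslice.symm

theorem apply_notched (hΨ : IsSliceRestriction Ψ) (k : Fin 3) :
    Ψ ⟨prinSeed.notched 1 k, prinSeed_notched_mem k⟩ = 1 := by
  have hnotched := congrArg Ψ (Subtype.ext (prinSeed_var_mul_notched k) :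
    (⟨_, var_mem_upperClusterAlgebra_prin .initial (Sum.inl k)⟩ :
        upperClusterAlgebra markovPrinMatrix) * ⟨_, prinSeed_notched_mem k⟩ =
      ⟨_, var_mem_upperClusterAlgebra_prin .initial (Sum.inr k)⟩ *
          ⟨_, prinSeed_loop_mem k⟩ ^ 2 +
        (1 - ⟨_, var_mem_upperClusterAlgebra_prin .initial (Sum.inr k)⟩ *
          ⟨_, var_mem_upperClusterAlgebra_prin .initial (Sum.inr (k + 1))⟩ *
          ⟨_, var_mem_upperClusterAlgebra_prin .initial (Sum.inr (k - 1))⟩) ^ 2)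
  have hprod : sliceCoeff paramS paramT k * sliceCoeff paramS paramT (k + 1) *
      sliceCoeff paramS paramT (k - 1) = paramS * paramT := by
    rw [← prod_fin_three _ one_ne_zero k, Fin.prod_univ_three]
    simp [sliceCoeff]
  simp only [map_mul, map_add, map_sub, map_one, map_pow, hΨ.apply_var_inl, hΨ.apply_var_inr,
    hΨ.apply_loop] at hnotched
  refine mul_left_cancel₀ (algebraMap_sliceArc_ne_zero k) (hnotched.trans ?_)
  rw [mul_one, ← map_mul, ← map_mul, hprod, sliceArc]
  simp only [map_mul, map_add, map_sub, map_one, map_pow]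

theorem exists_mul_eq (hΨ : IsSliceRestriction Ψ) (u : upperClusterAlgebra markovPrinMatrix) :
    ∃ a b : SliceRing, sliceBase b ≠ 0 ∧
      Ψ u * algebraMap SliceRing _ b = algebraMap SliceRing _ a := by
  refine exists_mul_eq_of_forall_prime (sliceBase : SliceRing →+* ℂ) (Ψ u) fun π hπ hπ₀ => ?_
  have hcoeff (j) : ¬π ∣ sliceCoeff paramS paramT j := fun ⟨c, hc⟩ =>
    sliceBase_sliceCoeff_ne_zero j (by
      rw [hc, map_mul]
      exact mul_eq_zero_of_left hπ₀ _)
  have hne {t : Seed 3 3} (ht : IsSeed markovPrinMatrix t) (i) : t.var i ≠ 0 :=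
    ht.var_ne_zero oriented_markovPrinMatrix.hasSkewPrincipalPart i
  rcases forall_not_dvd_sliceArc_or hπ hπ₀ with harc | ⟨k, hflip, harc⟩
  · exact exists_mul_eq_of_forall_not_dvd (hne .initial) _ hΨ hπ (Sum.rec harc hcoeff)
      (upperClusterAlgebra_le_laurentRing .initial u.2)
  · have hmutate : IsSeed markovPrinMatrix (prinSeed.mutate k) := .mutate _ k .initial
    refine exists_mul_eq_of_forall_not_dvd (hne hmutate)
      (fun i => var_mem_upperClusterAlgebra_prin hmutate i)
      (v := Function.update sliceVar (Sum.inl k) (sliceFlip paramS paramT k)) (fun i => ?_) hπ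
      (fun i => ?_) (upperClusterAlgebra_le_laurentRing hmutate u.2)
    · rcases eq_or_ne i (Sum.inl k) with rfl | hi
      · rw [Function.update_self]
        exact hΨ.apply_mutate_var k
      · rw [Function.update_of_ne hi, ← hΨ]
        exact congrArg Ψ (Subtype.ext (Seed.mutate_var_of_ne _ k hi))
    · rcases eq_or_ne i (Sum.inl k) with rfl | hi
      · rwa [Function.update_self]
      · rw [Function.update_of_ne hi]
        rcases i with j | j
        · exact harc j fun hj => hi (congrArg Sum.inl hj)
        · exact hcoeff j

end IsSliceRestriction

end SliceRestriction

section MysteriousPoint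

theorem notchedElt_scale {F : Type*} [Field F] {x₁ x₂ x₃ u₁ u₂ u₃ a₁ a₂ a₃ b₁ b₂ b₃ : F}
    (h₁ : a₁ ≠ 0) (h₂ : a₂ ≠ 0) (h₃ : a₃ ≠ 0) (e₁ : b₁ * a₂ ^ 2 = a₃ ^ 2)
    (e₂ : b₂ * a₃ ^ 2 = a₁ ^ 2) (e₃ : b₃ * a₁ ^ 2 = a₂ ^ 2) :
    notchedElt (a₁ * x₁) (a₂ * x₂) (a₃ * x₃) (b₁ * u₁) (b₂ * u₂) (b₃ * u₃) =
      a₁⁻¹ * notchedElt x₁ x₂ x₃ u₁ u₂ u₃ := by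
  obtain rfl : b₁ = a₃ ^ 2 / a₂ ^ 2 := by rw [eq_div_iff (pow_ne_zero 2 h₂), e₁]
  obtain rfl : b₂ = a₁ ^ 2 / a₃ ^ 2 := by rw [eq_div_iff (pow_ne_zero 2 h₃), e₂]
  obtain rfl : b₃ = a₂ ^ 2 / a₁ ^ 2 := by rw [eq_div_iff (pow_ne_zero 2 h₁), e₃]
  have hloop : loopElt (a₁ * x₁) (a₂ * x₂) (a₃ * x₃) (a₁ ^ 2 / a₃ ^ 2 * u₂)
      (a₂ ^ 2 / a₁ ^ 2 * u₃) = a₂ * a₃⁻¹ * loopElt x₁ x₂ x₃ u₂ u₃ := by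
    simp only [loopElt]
    field_simp
  rw [notchedElt, hloop, notchedElt]
  field_simp

variable {φ : clusterAut markovPrinMatrix} {ζ : Fin 3 ⊕ Fin 3 → ℂ}

theorem weight_mul_sq_eq_sq
    (hζ : ∀ i, fieldAut markovPrinMatrix φ (prinSeed.var i) = ζ i • prinSeed.var i) (k : Fin 3) :
    ζ (Sum.inr k) * ζ (Sum.inl (k + 1)) ^ 2 = ζ (Sum.inl (k - 1)) ^ 2 := by
  obtain ⟨ξ, -, hξ⟩ := exists_fieldAut_eq_smul φ
    ((IsSeed.initial (B := markovPrinMatrix)).mutate _ k |>.var_mem (Sum.inl k))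
  have hexchange := congrArg (fieldAut markovPrinMatrix φ) (prinSeed_var_mul_mutate_var k)
  rw [map_mul, map_add, map_mul, map_pow, map_pow, hζ, hζ, hζ, hζ, hξ, smul_mul_smul_comm,
    prinSeed_var_mul_mutate_var] at hexchange
  simp only [Algebra.smul_def] at hexchange
  have hrel : aeval prinSeed.var
      (C (ζ (Sum.inl k) * ξ) * (X (Sum.inr k) * X (Sum.inl (k + 1)) ^ 2 + X (Sum.inl (k - 1)) ^ 2) -
        (C (ζ (Sum.inr k)) * X (Sum.inr k) * (C (ζ (Sum.inl (k + 1))) * X (Sum.inl (k + 1))) ^ 2 +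
          (C (ζ (Sum.inl (k - 1))) * X (Sum.inl (k - 1))) ^ 2)) = 0 := by
    simp only [map_sub, map_add, map_mul, map_pow, aeval_X, aeval_C] at hexchange ⊢
    rw [hexchange, sub_self]
  have hzero := (map_eq_zero_iff _ (IsSeed.initial.algebraicIndependent
    oriented_markovPrinMatrix.hasSkewPrincipalPart)).1 hrel
  have hneg := congrArg (eval (Sum.elim (1 : Fin 3 → ℂ) (0 : Fin 3 → ℂ))) hzero
  have hboth := congrArg (eval 1) hzero
  simp only [map_sub, map_add, map_mul, map_pow, eval_C, eval_X, Sum.elim_inl, Sum.elim_inr,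
    Pi.one_apply, Pi.zero_apply, map_zero] at hneg hboth
  linear_combination -hboth + 2 * hneg

theorem fieldAut_prinSeed_notched
    (hζ : ∀ i, fieldAut markovPrinMatrix φ (prinSeed.var i) = ζ i • prinSeed.var i)
    (hζ₀ : ∀ i, ζ i ≠ 0) (k : Fin 3) :
    fieldAut markovPrinMatrix φ (prinSeed.notched 1 k) =
      (ζ (Sum.inl k))⁻¹ • prinSeed.notched 1 k := by
  have hne (i) : algebraMap ℂ (RatFun 3 3) (ζ i) ≠ 0 := (map_ne_zero _).2 (hζ₀ i)
  have hweight (j) : algebraMap ℂ (RatFun 3 3) (ζ (Sum.inr j)) * algebraMap ℂ _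
      (ζ (Sum.inl (j + 1))) ^ 2 = algebraMap ℂ _ (ζ (Sum.inl (j - 1))) ^ 2 := by
    rw [← map_pow, ← map_mul, weight_mul_sq_eq_sq hζ, map_pow]
  have hadd := hweight (k + 1)
  have hsub := hweight (k - 1)
  rw [fin_three_add_add, add_sub_cancel_right] at hadd
  rw [sub_add_cancel, fin_three_sub_sub] at hsub
  have hmap := map_notchedElt (fieldAut markovPrinMatrix φ : RatFun 3 3 →+* RatFun 3 3)
    (prinSeed.var (Sum.inl k)) (prinSeed.var (Sum.inl (k + 1))) (prinSeed.var (Sum.inl (k - 1)))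
    (prinSeed.var (Sum.inr k)) (prinSeed.var (Sum.inr (k + 1))) (prinSeed.var (Sum.inr (k - 1)))
  simp only [RingHom.coe_coe, hζ, Algebra.smul_def] at hmap
  rw [notchedElt_scale (hne _) (hne _) (hne _) (hweight k) hadd hsub] at hmap
  rw [Seed.notched, Algebra.smul_def, map_inv₀]
  simp only [prinSeed_coeff]
  exact hmap

theorem upperMysteriousPoints_markovPrinMatrix_nonempty :
    (upperMysteriousPoints markovPrinMatrix).Nonempty := by
  have hskew := oriented_markovPrinMatrix.hasSkewPrincipalPart
  have hle := oriented_markovPrinMatrix.clusterAlgebra_le_upperClusterAlgebra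
  obtain ⟨Ψ, hΨ⟩ := exists_isSliceRestriction
  obtain ⟨p, hp⟩ := exists_algHom_of_forall_mul_eq sliceBase Ψ hΨ.exists_mul_eq
  have hdeep : p ∈ deepLocus markovPrinMatrix (upperClusterAlgebra markovPrinMatrix) := by
    refine (comp_inclusion_mem_deepLocus_iff hskew hle).1
      ((mem_deepLocus_clusterAlgebra_iff hskew).2 fun t ht =>
        ⟨0, ht.coord_eq_zero_of_initial oriented_markovPrinMatrix (fun j => ?_) 0⟩)
    exact (hp _ _ (hΨ.apply_var_inl j)).trans (sliceBase_sliceArc j)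
  refine ⟨p, hdeep, fun hstab => hstab ((Subgroup.eq_bot_iff_forall _).2 fun φ hφ => ?_)⟩
  choose ζ hζ₀ hζ using fun i => exists_fieldAut_eq_smul φ (IsSeed.initial.var_mem i)
  have harc (k) : ζ (Sum.inl k) = 1 := by
    let notched : upperClusterAlgebra markovPrinMatrix := ⟨_, prinSeed_notched_mem k⟩
    have hnotched : p notched = 1 :=
      (hp _ 1 ((hΨ.apply_notched k).trans (map_one _).symm)).trans (map_one _)
    exact inv_eq_one.1 (eq_one_of_mem_pointStabilizer isRestrictedAction_upperAction hφ
      (r := notched) (fieldAut_prinSeed_notched hζ hζ₀ k) (hnotched.trans_ne one_ne_zero))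
  refine IsSeed.initial.eq_one_of_forall_fieldAut_eq hskew fun i => ?_
  have hone : ζ i = 1 := by
    rcases i with k | k
    · exact harc k
    · simpa only [harc, one_pow, mul_one] using weight_mul_sq_eq_sq hζ k
  rw [hζ, hone, one_smul]

end MysteriousPoint

section Denominators

theorem dvd_of_forall_prime_dvd_mul {P : Type*} [CommMonoidWithZero P] [UniqueFactorizationMonoid P]
    {a b : P} (hb : b ≠ 0) (h : ∀ π : P, Prime π → ∃ c, ¬π ∣ c ∧ b ∣ a * c) : b ∣ a := by
  induction b using UniqueFactorizationMonoid.induction_on_prime with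
  | h₁ => exact absurd rfl hb
  | h₂ x hx => exact hx.dvd
  | h₃ b π hb₀ hπ ih =>
    obtain ⟨d, rfl⟩ := ih hb₀ fun ϖ hϖ =>
      (h ϖ hϖ).imp fun c hc => ⟨hc.1, dvd_of_mul_left_dvd hc.2⟩
    obtain ⟨c, hπc, hdvd⟩ := h π hπ
    rw [mul_comm π b] at hdvd ⊢
    rw [mul_assoc, mul_dvd_mul_iff_left hb₀] at hdvd
    exact mul_dvd_mul_left b ((hπ.dvd_or_dvd hdvd).resolve_right hπc)

/-- The ideal of denominators of `u` over the subalgebra `S`: the elements `s` of `S` with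
`s * u ∈ S`. -/
def denomIdeal {F E : Type*} [CommSemiring F] [CommSemiring E] [Algebra F E] (S : Subalgebra F E)
    (u : E) : Ideal S :=
  (LinearMap.range (Algebra.linearMap S E)).comap (LinearMap.toSpanSingleton S E u)

theorem mem_denomIdeal {F E : Type*} [CommSemiring F] [CommSemiring E] [Algebra F E]
    {S : Subalgebra F E} {u : E} {s : S} : s ∈ denomIdeal S u ↔ (s : E) * u ∈ S :=
  ⟨fun ⟨r, hr⟩ => (show (r : E) = s * u from hr) ▸ r.2, fun h => ⟨⟨_, h⟩, rfl⟩⟩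

theorem prod_var_mem_radical_denomIdeal {n m : ℕ} {t : Seed n m} (h0 : ∀ i, t.var i ≠ 0)
    {S : Subalgebra ℂ (RatFun n m)} (hS : ∀ i, t.var i ∈ S) {u : RatFun n m}
    (hu : u ∈ laurentRing t) : ∏ i, (⟨t.var i, hS i⟩ : S) ∈ (denomIdeal S u).radical := by
  obtain ⟨N, g, hg⟩ := exists_mul_prod_pow_eq_aeval h0 hu
  refine ⟨N, mem_denomIdeal.2 ?_⟩
  push_cast
  rw [mul_comm, hg]
  exact aeval_mem hS g

end Denominators

section MarkovElement

theorem oriented_markovMatrix : Oriented markovMatrix 1 :=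
  oriented_of_toRows₁_eq (Matrix.toRows₁_fromRows _ _)

/-- The initial seed of the coefficient-free Markov cluster algebra. -/
noncomputable abbrev markovSeed : Seed 3 0 := initialSeed markovMatrix

/-- The element `(x₁² + x₂² + x₃²) / (x₁ x₂ x₃)` of the cluster of a seed, which the mutations
preserve. -/
noncomputable def Seed.markovElt (t : Seed 3 0) : RatFun 3 0 :=
  (∑ i, t.var (Sum.inl i) ^ 2) / ∏ i, t.var (Sum.inl i)

variable {t : Seed 3 0} {s : Fin 3}

theorem markov_var_ne_zero (ht : IsSeed markovMatrix t) (i : Fin 3 ⊕ Fin 0) : t.var i ≠ 0 :=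
  ht.var_ne_zero oriented_markovMatrix.hasSkewPrincipalPart i

theorem markov_var_mul_mutate_var (ht : IsSeed markovMatrix t) (hs : s ≠ 0) (k : Fin 3) :
    t.var (Sum.inl k) * (t.mutate k).var (Sum.inl k) =
      t.var (Sum.inl (k + s)) ^ 2 + t.var (Sum.inl (k - s)) ^ 2 := by
  obtain ⟨s', h⟩ := ht.exists_oriented oriented_markovMatrix
  have hsign : ∀ s s' : Fin 3, s ≠ 0 → s' ≠ 0 → s = s' ∨ s = -s' := by decide
  rw [ht.var_mul_mutate_var_eq oriented_markovMatrix h k]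
  rcases hsign s s' hs h.1 with rfl | rfl
  · simp [Seed.coeff, Seed.coeffDenom, laurentMonomial, posMonomial]
  · simp [Seed.coeff, Seed.coeffDenom, laurentMonomial, posMonomial, sub_neg_eq_add,
      ← sub_eq_add_neg, add_comm]

theorem markovElt_mul (ht : IsSeed markovMatrix t) (hs : s ≠ 0) (k : Fin 3) :
    t.var (Sum.inl (k + s)) * t.var (Sum.inl (k - s)) * t.markovElt =
      t.var (Sum.inl k) + (t.mutate k).var (Sum.inl k) := by
  have hsum := prod_fin_three (A := Multiplicative (RatFun 3 0))
    (fun i => .ofAdd (t.var (Sum.inl i) ^ 2)) hs k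
  have hx := markov_var_ne_zero ht
  have hsum : ∑ i, t.var (Sum.inl i) ^ 2 = t.var (Sum.inl k) ^ 2 + t.var (Sum.inl (k + s)) ^ 2 +
      t.var (Sum.inl (k - s)) ^ 2 := hsum
  refine mul_left_cancel₀ (hx (Sum.inl k)) ?_
  rw [mul_add, markov_var_mul_mutate_var ht hs, Seed.markovElt, prod_fin_three _ hs k,
    ← mul_assoc, ← mul_assoc, mul_div_cancel₀ _
      (mul_ne_zero (mul_ne_zero (hx _) (hx _)) (hx _)), hsum]
  ring

theorem markovElt_eq (ht : IsSeed markovMatrix t) : t.markovElt = markovSeed.markovElt := by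
  induction ht with
  | initial => rfl
  | mutate t k ht ih =>
    rw [← ih]
    have hx := markov_var_ne_zero ht
    have hmutate := markovElt_mul (ht.mutate t k) one_ne_zero k
    rw [ht.mutate_mutate oriented_markovMatrix.hasSkewPrincipalPart,
      t.mutate_var_of_ne k (by simp), t.mutate_var_of_ne k (by simp), add_comm ((t.mutate k).var _),
      ← markovElt_mul ht one_ne_zero k] at hmutate
    exact mul_left_cancel₀ (mul_ne_zero (hx _) (hx _)) hmutate

theorem markovElt_mem_laurentRing (t : Seed 3 0) : t.markovElt ∈ laurentRing t := by
  rw [Seed.markovElt, div_eq_mul_inv, ← Finset.prod_inv_distrib]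
  exact mul_mem (sum_mem fun i _ => pow_mem (var_mem_laurentRing t _) _)
    (prod_mem fun i _ => var_inv_mem_laurentRing t _)

theorem markovElt_mem_upperClusterAlgebra :
    markovSeed.markovElt ∈ upperClusterAlgebra markovMatrix := by
  simp only [upperClusterAlgebra, Algebra.mem_iInf]
  intro t ht
  rw [← markovElt_eq ht]
  exact markovElt_mem_laurentRing t

end MarkovElement

section MarkovAlgebra

/-- The subalgebra generated by the initial cluster and the element `Seed.markovElt`; it turns out
to be the upper cluster algebra of the Markov quiver. -/
noncomputable def markovAlgebra : Subalgebra ℂ (RatFun 3 0) :=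
  Algebra.adjoin ℂ (insert markovSeed.markovElt (Set.range fun i => markovSeed.var (Sum.inl i)))

/-- The initial cluster variables as elements of `markovAlgebra`. -/
noncomputable def markovVar (i : Fin 3) : markovAlgebra :=
  ⟨markovSeed.var (Sum.inl i), Algebra.subset_adjoin (Or.inr ⟨i, rfl⟩)⟩

/-- The mutation invariant `Seed.markovElt` as an element of `markovAlgebra`. -/
noncomputable def markovConst : markovAlgebra :=
  ⟨markovSeed.markovElt, Algebra.subset_adjoin (Or.inl rfl)⟩

/-- The cluster variable created by mutating the initial seed at `k`, written as the second root of
the quadratic polynomial over `markovAlgebra` satisfied by `markovVar k`. -/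
noncomputable def markovFlip (k : Fin 3) : markovAlgebra :=
  markovVar (k + 1) * markovVar (k - 1) * markovConst - markovVar k

theorem coe_markovFlip (k : Fin 3) :
    (markovFlip k : RatFun 3 0) = (markovSeed.mutate k).var (Sum.inl k) :=
  sub_eq_of_eq_add' (markovElt_mul .initial one_ne_zero k)

theorem markovVar_mul_markovConst {s : Fin 3} (hs : s ≠ 0) (k : Fin 3) :
    markovVar (k + s) * markovVar (k - s) * markovConst = markovVar k + markovFlip k :=
  Subtype.ext <| (markovElt_mul .initial hs k).trans
    (congrArg (markovSeed.var (Sum.inl k) + ·) (coe_markovFlip k).symm)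

theorem markovVar_mul_markovFlip {s : Fin 3} (hs : s ≠ 0) (k : Fin 3) :
    markovVar k * markovFlip k = markovVar (k + s) ^ 2 + markovVar (k - s) ^ 2 :=
  Subtype.ext <| (congrArg (markovSeed.var (Sum.inl k) * ·) (coe_markovFlip k)).trans
    (markov_var_mul_mutate_var .initial hs k)

theorem markovConst_relation :
    markovVar 1 * markovVar 2 * markovConst = markovVar 0 + markovFlip 0 :=
  markovVar_mul_markovConst one_ne_zero 0

theorem markovFlip_zero_relation :
    markovVar 0 * markovFlip 0 = markovVar 1 ^ 2 + markovVar 2 ^ 2 :=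
  markovVar_mul_markovFlip one_ne_zero 0

theorem markovVar_zero_sq : markovVar 0 ^ 2 = markovVar 1 * markovVar 2 * markovConst *
    markovVar 0 - (markovVar 1 ^ 2 + markovVar 2 ^ 2) := by
  linear_combination -markovVar 0 * markovConst_relation - markovFlip_zero_relation

theorem markovAlgebra_le_laurentRing : markovAlgebra ≤ laurentRing markovSeed := by
  refine Algebra.adjoin_le (Set.insert_subset (markovElt_mem_laurentRing _) ?_)
  rintro _ ⟨i, rfl⟩
  exact var_mem_laurentRing _ _

/-- The family `(M, x₂, x₃)`, where `M` is the invariant `markovConst`. -/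
noncomputable def markovParam : Fin 3 → markovAlgebra :=
  Function.update markovVar 0 markovConst

theorem algebraicIndependent_markovParam :
    AlgebraicIndependent ℂ fun i => (markovParam i : RatFun 3 0) := by
  refine algebraicIndependent_of_isAlgebraic_adjoin _ ?_ (by simp [trdeg_ratFun])
  set L := IntermediateField.adjoin ℂ (Set.range fun i => (markovParam i : RatFun 3 0))
  have hparam (i) : IsAlgebraic L (markovParam i : RatFun 3 0) :=
    isAlgebraic_algebraMap (⟨_, IntermediateField.subset_adjoin _ _ ⟨i, rfl⟩⟩ : L)
  have hzero : IsAlgebraic L (markovVar 0 : RatFun 3 0) := by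
    let gen (i) : L := ⟨markovParam i, IntermediateField.subset_adjoin _ _ ⟨i, rfl⟩⟩
    refine ⟨.X ^ 2 - .C (gen 1 * gen 2 * gen 0) * .X + .C (gen 1 ^ 2 + gen 2 ^ 2),
      Polynomial.Monic.ne_zero (by monicity!), ?_⟩
    have hgen : (algebraMap L (RatFun 3 0) (gen 0) = markovConst) ∧
        (algebraMap L (RatFun 3 0) (gen 1) = markovVar 1) ∧
        (algebraMap L (RatFun 3 0) (gen 2) = markovVar 2) := ⟨rfl, rfl, rfl⟩
    have hquad := congrArg Subtype.val markovVar_zero_sq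
    push_cast at hquad
    simp only [map_add, map_sub, map_mul, map_pow, Polynomial.aeval_X, Polynomial.aeval_C, hgen]
    linear_combination hquad
  have hvar : Set.range markovSeed.var ⊆
      ((algebraicClosure L (RatFun 3 0)).restrictScalars ℂ : Set (RatFun 3 0)) := by
    rintro _ ⟨i | j, rfl⟩
    · rcases eq_or_ne i 0 with rfl | hi
      · exact mem_algebraicClosure_iff.2 hzero
      · have hi' := hparam i
        rw [markovParam, Function.update_of_ne hi] at hi'
        exact mem_algebraicClosure_iff.2 hi'
    · exact j.elim0
  have htop := IntermediateField.adjoin_le_iff.2 hvar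
  rw [adjoin_initialSeed_eq_top] at htop
  exact ⟨fun z => mem_algebraicClosure_iff.1 (htop (IntermediateField.mem_top (x := z)))⟩

/-- The embedding of the polynomial ring in `M`, `x₂`, `x₃`. -/
noncomputable def markovPoly : MvPolynomial (Fin 3) ℂ →ₐ[ℂ] markovAlgebra :=
  aeval markovParam

theorem markovPoly_X_zero : markovPoly (X 0) = markovConst := by
  simp [markovPoly, markovParam]

theorem markovPoly_X {i : Fin 3} (hi : i ≠ 0) : markovPoly (X i) = markovVar i := by
  simp [markovPoly, markovParam, hi]

theorem markovPoly_injective : Function.Injective markovPoly := fun p q h =>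
  algebraicIndependent_markovParam <| by
    have hmem (i) : (markovParam i : RatFun 3 0) ∈ markovAlgebra := (markovParam i).2
    rw [← coe_aeval_mk hmem p, ← coe_aeval_mk hmem q]
    exact congrArg Subtype.val h

theorem exists_eq_markovPoly_add (z : markovAlgebra) :
    ∃ a b, z = markovPoly a + markovPoly b * markovVar 0 := by
  suffices h : ∀ z ∈ markovAlgebra, ∃ a b,
      z = ((markovPoly a + markovPoly b * markovVar 0 : markovAlgebra) : RatFun 3 0) from
    (h z z.2).imp fun a => Exists.imp fun b h => Subtype.ext h
  intro z hz
  induction hz using Algebra.adjoin_induction with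
  | mem z hz =>
    rcases hz with rfl | ⟨i, rfl⟩
    · exact ⟨X 0, 0, by simp [markovPoly_X_zero, markovConst]⟩
    · rcases eq_or_ne i 0 with rfl | hi
      · exact ⟨0, 1, by simp [markovVar]⟩
      · exact ⟨X i, 0, by simp [markovPoly_X hi, markovVar]⟩
  | algebraMap r => exact ⟨C r, 0, by simp [markovPoly]⟩
  | add z w _ _ hz hw =>
    obtain ⟨⟨a, b, rfl⟩, ⟨c, d, rfl⟩⟩ := And.intro hz hw
    exact ⟨a + c, b + d, by simp only [map_add]; push_cast; ring⟩
  | mul z w _ _ hz hw =>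
    obtain ⟨⟨a, b, rfl⟩, ⟨c, d, rfl⟩⟩ := And.intro hz hw
    refine ⟨a * c - b * d * (X 1 ^ 2 + X 2 ^ 2), a * d + b * c + b * d * (X 1 * X 2 * X 0), ?_⟩
    rw [← Subalgebra.coe_mul]
    simp only [map_add, map_sub, map_mul, map_pow, markovPoly_X_zero,
      markovPoly_X (one_ne_zero (α := Fin 3)), markovPoly_X (show (2 : Fin 3) ≠ 0 by decide)]
    congr 1
    linear_combination (markovPoly b * markovPoly d) * markovVar_zero_sq

theorem exists_laurentRing_algHom_markovFlip : ∃ σ : markovAlgebra →ₐ[ℂ] RatFun 3 0,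
    (∀ a, σ (markovPoly a) = markovPoly a) ∧ σ (markovVar 0) = markovFlip 0 := by
  have hmutate : IsSeed markovMatrix (markovSeed.mutate 0) := .mutate _ 0 .initial
  have hskew := oriented_markovMatrix.hasSkewPrincipalPart
  obtain ⟨q, hq⟩ := exists_laurentRing_algHom (IsSeed.initial.algebraicIndependent hskew)
    (hmutate.var_ne_zero hskew)
  let σ := q.comp (Subalgebra.inclusion markovAlgebra_le_laurentRing)
  have hzero : σ (markovVar 0) = markovFlip 0 := (hq (Sum.inl 0)).trans (coe_markovFlip 0).symm
  have hne {i : Fin 3} (hi : i ≠ 0) : σ (markovVar i) = markovVar i :=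
    (hq (Sum.inl i)).trans (markovSeed.mutate_var_of_ne 0 (by simpa using hi))
  have hconst : σ markovConst = markovConst := by
    have hprod : σ (markovVar 0) * σ (markovFlip 0) = markovFlip 0 * markovVar 0 := by
      rw [← map_mul, markovFlip_zero_relation, map_add, map_pow, map_pow, hne one_ne_zero,
        hne (by decide : (2 : Fin 3) ≠ 0), mul_comm]
      exact congrArg Subtype.val markovFlip_zero_relation.symm
    have hsum := congrArg σ markovConst_relation
    rw [hzero] at hprod
    rw [map_mul, map_mul, map_add, hne one_ne_zero, hne (by decide : (2 : Fin 3) ≠ 0), hzero,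
      mul_left_cancel₀ (by rw [coe_markovFlip]; exact hmutate.var_ne_zero hskew _) hprod,
      add_comm] at hsum
    exact mul_left_cancel₀ (mul_ne_zero (markov_var_ne_zero .initial _)
      (markov_var_ne_zero .initial _)) (hsum.trans (congrArg Subtype.val markovConst_relation).symm)
  have hparam (i) : σ (markovParam i) = markovParam i := by
    rcases eq_or_ne i 0 with rfl | hi
    · simpa [markovParam] using hconst
    · simpa [markovParam, hi] using hne hi
  have hcomp : σ.comp markovPoly = markovAlgebra.val.comp markovPoly :=
    MvPolynomial.algHom_ext fun i => by simp [markovPoly, hparam]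
  exact ⟨σ, fun a => congrArg (· a) hcomp, hzero⟩

theorem markovFlip_zero_ne : markovFlip 0 ≠ markovVar 0 := by
  intro h
  obtain ⟨q, hq⟩ := exists_laurentRing_algHom (c := 1)
    (IsSeed.initial.algebraicIndependent oriented_markovMatrix.hasSkewPrincipalPart)
    fun _ => one_ne_zero (α := ℂ)
  let p := q.comp (Subalgebra.inclusion markovAlgebra_le_laurentRing)
  have hp (i) : p (markovVar i) = 1 := hq (Sum.inl i)
  have := congrArg p markovFlip_zero_relation
  rw [h, map_mul, map_add, map_pow, map_pow, hp, hp, hp] at this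
  norm_num at this

theorem eq_zero_of_markovPoly_add_eq_zero {a b : MvPolynomial (Fin 3) ℂ}
    (h : markovPoly a + markovPoly b * markovVar 0 = 0) : a = 0 ∧ b = 0 := by
  obtain ⟨σ, hσ, hσ₀⟩ := exists_laurentRing_algHom_markovFlip
  have hflip : markovPoly a + markovPoly b * markovFlip 0 = 0 := by
    have hmap := congrArg σ h
    rw [map_add, map_mul, hσ, hσ, hσ₀, map_zero] at hmap
    exact Subtype.ext hmap
  have hb : b = 0 := by
    have hmul : markovPoly b * (markovFlip 0 - markovVar 0) = 0 := by linear_combination hflip - h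
    exact markovPoly_injective <| ((mul_eq_zero.1 hmul).resolve_right
      (sub_ne_zero.2 markovFlip_zero_ne)).trans (map_zero _).symm
  subst hb
  rw [map_zero, zero_mul, add_zero] at h
  exact ⟨markovPoly_injective (h.trans (map_zero _).symm), rfl⟩

theorem mem_markovAlgebra_of_forall_prime {u : RatFun 3 0}
    (h : ∀ π : MvPolynomial (Fin 3) ℂ, Prime π →
      ∃ q, ¬π ∣ q ∧ markovPoly q ∈ (denomIdeal markovAlgebra u).radical) :
    u ∈ markovAlgebra := by
  have hdenom (π : MvPolynomial (Fin 3) ℂ) (hπ : Prime π) : ∃ q a b, ¬π ∣ q ∧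
      (markovPoly q : RatFun 3 0) * u = (markovPoly a + markovPoly b * markovVar 0 :) := by
    obtain ⟨q, hπq, N, hN⟩ := h π hπ
    rw [← map_pow, mem_denomIdeal] at hN
    obtain ⟨a, b, hab⟩ := exists_eq_markovPoly_add ⟨_, hN⟩
    exact ⟨q ^ N, a, b, fun hdvd => hπq (hπ.dvd_of_dvd_pow hdvd), congrArg Subtype.val hab⟩
  obtain ⟨q, a, b, hXq, hq⟩ := hdenom (X 0) X_prime
  have hq₀ : q ≠ 0 := by
    rintro rfl
    exact hXq (dvd_zero _)
  have hcross (π : MvPolynomial (Fin 3) ℂ) (hπ : Prime π) :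
      ∃ r, ¬π ∣ r ∧ q ∣ a * r ∧ q ∣ b * r := by
    obtain ⟨r, c, d, hπr, hr⟩ := hdenom π hπ
    have hzero : markovPoly (a * r - q * c) + markovPoly (b * r - q * d) * markovVar 0 = 0 := by
      refine Subtype.ext ?_
      simp only [map_sub, map_mul]
      push_cast at hq hr ⊢
      linear_combination (markovPoly q : RatFun 3 0) * hr - markovPoly r * hq
    obtain ⟨ha, hb⟩ := eq_zero_of_markovPoly_add_eq_zero hzero
    exact ⟨r, hπr, ⟨c, sub_eq_zero.1 ha⟩, ⟨d, sub_eq_zero.1 hb⟩⟩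
  obtain ⟨a, rfl⟩ := dvd_of_forall_prime_dvd_mul hq₀ fun π hπ =>
    (hcross π hπ).imp fun _ hr => ⟨hr.1, hr.2.1⟩
  obtain ⟨b, rfl⟩ := dvd_of_forall_prime_dvd_mul hq₀ fun π hπ =>
    (hcross π hπ).imp fun _ hr => ⟨hr.1, hr.2.2⟩
  have hu : u = (markovPoly a + markovPoly b * markovVar 0 :) := by
    refine mul_left_cancel₀ (a := (markovPoly q : RatFun 3 0)) ?_ ?_
    · simpa [map_eq_zero_iff _ markovPoly_injective] using hq₀
    · rw [hq, ← Subalgebra.coe_mul, map_mul, map_mul]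
      congr 1
      ring
  exact hu ▸ Subtype.property _

end MarkovAlgebra

section UpperMarkov

theorem clusterAlgebra_le_upperClusterAlgebra_markovMatrix :
    clusterAlgebra markovMatrix ≤ upperClusterAlgebra markovMatrix :=
  oriented_markovMatrix.clusterAlgebra_le_upperClusterAlgebra

section Radical

variable {u : RatFun 3 0} {s : Fin 3}

theorem mul_mem_radical_denomIdeal {t : Seed 3 0} (ht : IsSeed markovMatrix t)
    {y : Fin 3 → markovAlgebra} (hy : ∀ i, t.var (Sum.inl i) = y i)
    (hu : u ∈ upperClusterAlgebra markovMatrix) (hs : s ≠ 0) (k : Fin 3) :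
    y k * y (k + s) * y (k - s) ∈ (denomIdeal markovAlgebra u).radical := by
  have hmem : ∀ i, t.var i ∈ markovAlgebra :=
    Sum.rec (fun i => hy i ▸ Subtype.property _) fun j => j.elim0
  have hprod := prod_var_mem_radical_denomIdeal (markov_var_ne_zero ht) hmem
    (upperClusterAlgebra_le_laurentRing ht hu)
  have hval (i) : (⟨t.var (Sum.inl i), hmem _⟩ : markovAlgebra) = y i := Subtype.ext (hy i)
  rwa [Fintype.prod_sum_type, Finset.univ_eq_empty (α := Fin 0), Finset.prod_empty, mul_one,
    Finset.prod_congr rfl fun i _ => hval i, prod_fin_three _ hs k] at hprod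

theorem markovVar_mul_mem_radical (hu : u ∈ upperClusterAlgebra markovMatrix) (hs : s ≠ 0)
    (k : Fin 3) : markovVar k * markovVar (k + s) * markovVar (k - s) ∈
      (denomIdeal markovAlgebra u).radical :=
  mul_mem_radical_denomIdeal .initial (fun _ => rfl) hu hs k

theorem markovFlip_mul_mem_radical (hu : u ∈ upperClusterAlgebra markovMatrix) (hs : s ≠ 0)
    (k : Fin 3) : markovFlip k * markovVar (k + s) * markovVar (k - s) ∈
      (denomIdeal markovAlgebra u).radical := by
  have hvar (i) : (markovSeed.mutate k).var (Sum.inl i) =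
      (Function.update markovVar k (markovFlip k) i : markovAlgebra) := by
    rcases eq_or_ne i k with rfl | hi
    · rw [Function.update_self, coe_markovFlip]
    · rw [Function.update_of_ne hi, markovSeed.mutate_var_of_ne k (by simpa using hi)]
      rfl
  have hprod := mul_mem_radical_denomIdeal (.mutate _ k .initial) hvar hu hs k
  rwa [Function.update_self, Function.update_of_ne (by simpa using hs),
    Function.update_of_ne (by simpa using hs)] at hprod

theorem markovPoly_mem_radical_of_zero (hu : u ∈ upperClusterAlgebra markovMatrix) :
    markovPoly (X 1 * X 2 * (X 1 ^ 2 + X 2 ^ 2)) ∈ (denomIdeal markovAlgebra u).radical := by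
  have hmem : markovFlip 0 * (markovVar 0 * markovVar 1 * markovVar 2) ∈ _ :=
    Ideal.mul_mem_left _ _ (markovVar_mul_mem_radical hu one_ne_zero 0)
  simp only [map_mul, map_add, map_pow, markovPoly_X one_ne_zero,
    markovPoly_X (by decide : (2 : Fin 3) ≠ 0)]
  convert hmem using 1
  linear_combination -markovVar 1 * markovVar 2 * markovFlip_zero_relation

theorem markovPoly_mem_radical_of_const (hu : u ∈ upperClusterAlgebra markovMatrix) :
    markovPoly (X 1 ^ 2 * X 2 ^ 2 * X 0) ∈ (denomIdeal markovAlgebra u).radical := by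
  have hmem : markovVar 0 * markovVar 1 * markovVar 2 + markovFlip 0 * markovVar 1 * markovVar 2 ∈
      (denomIdeal markovAlgebra u).radical :=
    add_mem (markovVar_mul_mem_radical hu one_ne_zero 0)
      (markovFlip_mul_mem_radical hu one_ne_zero 0)
  simp only [map_mul, map_pow, markovPoly_X_zero, markovPoly_X one_ne_zero,
    markovPoly_X (by decide : (2 : Fin 3) ≠ 0)]
  convert hmem using 1
  linear_combination (markovVar 1 * markovVar 2) * markovConst_relation

theorem markovPoly_mem_radical_of_var (hu : u ∈ upperClusterAlgebra markovMatrix) (hs : s ≠ 0) :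
    markovPoly ((X (-s) ^ 4 * X 0 ^ 2 + X s ^ 2) * X (-s) * (X s ^ 2 + X (-s) ^ 2)) ∈
      (denomIdeal markovAlgebra u).radical := by
  have hadd : ∀ s : Fin 3, s + s = -s := by decide
  have hmem := Ideal.mul_mem_left _
    (markovFlip 0 * (markovVar (-s) * markovFlip 0 * markovConst - markovVar s))
    (markovFlip_mul_mem_radical hu hs s)
  have hmul := markovVar_mul_markovFlip hs 0
  have hconst := markovVar_mul_markovConst hs 0
  have hflip := markovVar_mul_markovConst hs s
  simp only [hadd, sub_self, zero_add, zero_sub] at hmem hmul hconst hflip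
  simp only [map_add, map_mul, map_pow, markovPoly_X_zero, markovPoly_X hs,
    markovPoly_X (neg_ne_zero.2 hs)]
  convert hmem using 1
  linear_combination
    (markovVar (-s) * (markovVar s ^ 2 + markovVar (-s) ^ 2)) *
      ((markovVar (-s) * markovFlip 0 * markovConst - markovVar s) * hflip -
        markovVar (-s) ^ 2 * markovConst ^ 2 * hmul -
        markovVar s * markovVar (-s) * markovConst * hconst) -
    markovVar (-s) * markovFlip s *
      (markovVar (-s) * markovFlip 0 * markovConst - markovVar s) * hmul

theorem not_dvd_of_eval_ne_zero {ι K : Type*} [Field K] {π q : MvPolynomial ι K} (hπ : Prime π)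
    {i : ι} (hi : π ∣ X i) {v : ι → K} (hv : v i = 0) (hq : eval v q ≠ 0) : ¬π ∣ q := by
  intro hdvd
  obtain ⟨c, hc⟩ := ((hπ.irreducible.associated_of_dvd X_prime.irreducible hi).dvd'.trans hdvd)
  simp [hc, hv] at hq

theorem exists_markovPoly_mem_radical (hu : u ∈ upperClusterAlgebra markovMatrix)
    {π : MvPolynomial (Fin 3) ℂ} (hπ : Prime π) :
    ∃ q, ¬π ∣ q ∧ markovPoly q ∈ (denomIdeal markovAlgebra u).radical := by
  by_cases hX : ∃ s : Fin 3, s ≠ 0 ∧ π ∣ X s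
  · obtain ⟨s, hs, hdvd⟩ := hX
    refine ⟨_, not_dvd_of_eval_ne_zero hπ hdvd (v := Function.update 1 s 0) (by simp) ?_,
      markovPoly_mem_radical_of_var hu hs⟩
    have hneg : ∀ s : Fin 3, s ≠ 0 → -s ≠ s := by decide
    simp [hs.symm, hneg s hs]
  push Not at hX
  have hX₁ := hX 1 one_ne_zero
  have hX₂ := hX 2 (by decide)
  by_cases hsum : π ∣ X 1 ^ 2 + X 2 ^ 2
  · refine ⟨_, hπ.not_dvd_mul (hπ.not_dvd_mul ?_ ?_) fun hX₀ => ?_,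
      markovPoly_mem_radical_of_const hu⟩
    · exact fun h => hX₁ (hπ.dvd_of_dvd_pow h)
    · exact fun h => hX₂ (hπ.dvd_of_dvd_pow h)
    · exact not_dvd_of_eval_ne_zero hπ hX₀ (v := ![0, 1, 1]) rfl (by simp) hsum
  · exact ⟨_, hπ.not_dvd_mul (hπ.not_dvd_mul hX₁ hX₂) hsum, markovPoly_mem_radical_of_zero hu⟩

end Radical

theorem markovAlgebra_eq_upperClusterAlgebra :
    markovAlgebra = upperClusterAlgebra markovMatrix := by
  refine le_antisymm (Algebra.adjoin_le (Set.insert_subset markovElt_mem_upperClusterAlgebra ?_))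
    fun u hu => mem_markovAlgebra_of_forall_prime fun π hπ => exists_markovPoly_mem_radical hu hπ
  rintro _ ⟨i, rfl⟩
  exact clusterAlgebra_le_upperClusterAlgebra_markovMatrix
    (IsSeed.initial.var_mem_clusterAlgebra _)

theorem map_markovElt_eq_smul {σ : RatFun 3 0 ≃ₐ[ℂ] RatFun 3 0} {ε : Fin 3 → ℂ}
    (hε : ∀ i, ε i ^ 2 = 1)
    (hσ : ∀ i, σ (markovSeed.var (Sum.inl i)) = ε i • markovSeed.var (Sum.inl i)) :
    σ markovSeed.markovElt = (∏ i, ε i) • markovSeed.markovElt := by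
  have hinv : (∏ i, ε i)⁻¹ = ∏ i, ε i := by
    refine inv_eq_of_mul_eq_one_left ?_
    rw [← Finset.prod_mul_distrib]
    exact Finset.prod_eq_one fun i _ => by rw [← sq, hε]
  rw [← hinv, Seed.markovElt, map_div₀, map_sum, map_prod]
  simp only [map_pow, hσ, smul_pow, hε, one_smul]
  simp only [Algebra.smul_def, Finset.prod_mul_distrib, ← map_prod, map_inv₀]
  rw [div_mul_eq_div_div_swap, div_eq_inv_mul]

theorem coord_mul_apply_markovElt (p : Points (upperClusterAlgebra markovMatrix)) (k : Fin 3) :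
    let p' := p.comp (Subalgebra.inclusion clusterAlgebra_le_upperClusterAlgebra_markovMatrix)
    IsSeed.initial.coord p' (Sum.inl (k + 1)) * IsSeed.initial.coord p' (Sum.inl (k - 1)) *
        p ⟨markovSeed.markovElt, markovElt_mem_upperClusterAlgebra⟩ =
      IsSeed.initial.coord p' (Sum.inl k) +
        (IsSeed.initial.mutate _ k).coord p' (Sum.inl k) := by
  have hle := clusterAlgebra_le_upperClusterAlgebra_markovMatrix
  have hinitial : IsSeed markovMatrix markovSeed := .initial
  let x (j) : upperClusterAlgebra markovMatrix :=
    ⟨_, hle (hinitial.var_mem_clusterAlgebra (Sum.inl j))⟩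
  let x' : upperClusterAlgebra markovMatrix :=
    ⟨_, hle ((hinitial.mutate _ k).var_mem_clusterAlgebra (Sum.inl k))⟩
  have hrel : x (k + 1) * x (k - 1) * ⟨_, markovElt_mem_upperClusterAlgebra⟩ = x k + x' :=
    Subtype.ext (markovElt_mul hinitial one_ne_zero k)
  have hp := congrArg p hrel
  rwa [map_mul, map_mul, map_add] at hp

theorem exists_sign_of_mem_deepLocus {p : Points (upperClusterAlgebra markovMatrix)}
    (hp : p ∈ deepLocus markovMatrix (upperClusterAlgebra markovMatrix)) :
    ∃ (ε : Fin 3 → ℂ) (i : Fin 3), (∀ j, ε j ^ 2 = 1) ∧ ε i ≠ 1 ∧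
      (∀ j, ε j = 1 ∨ p ⟨markovSeed.var (Sum.inl j),
        clusterAlgebra_le_upperClusterAlgebra_markovMatrix
          (IsSeed.initial.var_mem_clusterAlgebra _)⟩ = 0) ∧
      (∏ j, ε j = 1 ∨ p ⟨markovSeed.markovElt, markovElt_mem_upperClusterAlgebra⟩ = 0) := by
  have hB := oriented_markovMatrix
  have hle := clusterAlgebra_le_upperClusterAlgebra_markovMatrix
  have hinitial : IsSeed markovMatrix markovSeed := .initial
  let p' : Points (clusterAlgebra markovMatrix) := p.comp (Subalgebra.inclusion hle)
  have hp' : p' ∈ deepLocus markovMatrix (clusterAlgebra markovMatrix) :=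
    (comp_inclusion_mem_deepLocus_iff hB.hasSkewPrincipalPart hle).2 hp
  by_cases hzero : ∀ j, hinitial.coord p' (Sum.inl j) = 0
  · exact ⟨![-1, -1, 1], 0, fun j => by fin_cases j <;> simp, by simp; norm_num,
      fun j => Or.inr (hzero j), Or.inl (by simp [Fin.prod_univ_three])⟩
  obtain ⟨i, hi⟩ := (mem_deepLocus_clusterAlgebra_iff hB.hasSkewPrincipalPart).1 hp' _ hinitial
  have hflip := (hinitial.coord_mutate_eq_zero_iff hB hp' i i).2 hi
  refine ⟨Function.update 1 i (-1), i, fun j => ?_, by simp; norm_num, fun j => ?_, Or.inr ?_⟩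
  · rcases eq_or_ne j i with rfl | hj <;> simp [*]
  · rcases eq_or_ne j i with rfl | hj
    · exact Or.inr hi
    · exact Or.inl (by simp [hj])
  · have hne {j} (hj : j ≠ i) : hinitial.coord p' (Sum.inl j) ≠ 0 := fun h => hzero fun l => by
      rcases eq_or_ne l i with rfl | hl
      · exact hi
      · exact (hinitial.coord_eq_zero_iff_of_mul_eq_zero hB (by rw [hi, zero_mul]) hj hl).1 h
    have hrel := coord_mul_apply_markovElt p i
    simp only at hrel
    rw [hi, hflip, add_zero] at hrel
    exact (mul_eq_zero.1 hrel).resolve_left (mul_ne_zero (hne (by simp)) (hne (by simp)))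

theorem upperHasNoMysteriousPoints_markovMatrix : UpperHasNoMysteriousPoints markovMatrix := by
  have hB := oriented_markovMatrix
  have hle := clusterAlgebra_le_upperClusterAlgebra_markovMatrix
  refine (stabilizerLocus_subset_deepLocus hB.hasSkewPrincipalPart hle
    isRestrictedAction_upperAction).antisymm fun p hp hbot => ?_
  obtain ⟨ε, i, hε, hi, hvar, helt⟩ := exists_sign_of_mem_deepLocus hp
  obtain ⟨φ, hφ⟩ := hB.exists_clusterAut_sign hε
  have hφ1 : φ ≠ 1 := ne_one_of_fieldAut_eq_smul (hφ _ .initial (Sum.inl i))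
    (markov_var_ne_zero .initial _) hi
  refine hφ1 ((Subgroup.eq_bot_iff_forall _).1 hbot φ ?_)
  refine mem_pointStabilizer_of_adjoin_eq isRestrictedAction_upperAction
    markovAlgebra_eq_upperClusterAlgebra ?_
  rintro z hz (rfl | ⟨j, rfl⟩)
  · exact ⟨_, map_markovElt_eq_smul hε fun j => hφ _ .initial (Sum.inl j), helt⟩
  · exact ⟨_, hφ _ .initial (Sum.inl j), hvar j⟩

end UpperMarkov

end ClusterAlg

theorem proposition3p16_general :
    (∀ {m : ℕ} (B : Matrix (Fin 3 ⊕ Fin m) (Fin 3) ℤ), B.toRows₁ = ClusterAlg.markovPrincipal →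
      ClusterAlg.ClusterHasNoMysteriousPoints B) ∧
    (ClusterAlg.upperMysteriousPoints ClusterAlg.markovPrinMatrix).Nonempty ∧
    ClusterAlg.UpperHasNoMysteriousPoints ClusterAlg.markovMatrix :=
  ⟨fun _ hB => (ClusterAlg.oriented_of_toRows₁_eq hB).clusterHasNoMysteriousPoints,
    ClusterAlg.upperMysteriousPoints_markovPrinMatrix_nonempty,
    ClusterAlg.upperHasNoMysteriousPoints_markovMatrix⟩

theorem proposition3p16 :
    ClusterAlg.ClusterHasNoMysteriousPoints ClusterAlg.markovPrinMatrix ∧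
    (ClusterAlg.upperMysteriousPoints ClusterAlg.markovPrinMatrix).Nonempty ∧
    ClusterAlg.ClusterHasNoMysteriousPoints ClusterAlg.markovMatrix ∧
    ClusterAlg.UpperHasNoMysteriousPoints ClusterAlg.markovMatrix := by
  obtain ⟨hA, hprin, hU⟩ := proposition3p16_general
  exact ⟨hA _ (Matrix.toRows₁_fromRows _ _), hprin, hA _ (Matrix.toRows₁_fromRows _ _), hU⟩
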